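/- Let $R=\mathbb R[[t]]$, $\mathfrak m=(t)$, and write $\bar p=p(0)$ for $p\in R$. The real Gelfand order is the $\mathbb R$-algebra $$A=\left\{(a_{ij})\in M_3(R)\;\middle|\;\bar a_{13}=\bar a_{23}=0,\ \bar a_{11}=\bar a_{22},\ \bar a_{21}=-\bar a_{12}\right\}.$$ Let $e=\mathrm{diag}(1,1,0)$ and $f=\mathrm{diag}(0,0,1)$ in $A$. Let $S$ be the simple $A$-module $\mathbb C$ on which $a$ acts as $\bar a_{11}+i\,\bar a_{21}$, and $T$ the simple $A$-module $\mathbb R$ on which $a$ acts as $\bar a_{33}$. The dimension vector of a finite dimensional $A$-module $M$ is $\left(\tfrac12\dim_{\mathbb R}eM,\ \dim_{\mathbb R}fM\right)$. The top of $M$ is $M/\mathrm{rad}(M)$, where $\mathrm{rad}(M)$ is the intersection of the maximal submodules of $M$; a finite dimensional $A$-module is absolutely cyclic if its top is simple. Consider the $A$-lattices $$P=Ae=\left\{x\in \mathrm{Mat}_{3\times 2}(R)\;\middle|\;\bar x_{11}=\bar x_{22},\ \bar x_{21}=-\bar x_{12}\right\},\qquad Q=Af=\begin{bmatrix}\mathfrak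 m\\ \mathfrak m\\ R\end{bmatrix},\qquad L=\begin{bmatrix}R\\R\\R\end{bmatrix},$$ on which $A$ acts by left multiplication. View a direct sum of two of the lattices $Q,L$ as a set of $3\times2$ matrices, the summands being the columns; a matrix over $R$ written on an arrow denotes right multiplication by it. Let $\mathbb N=\{1,2,\dots\}$ and $\mathbb N_0=\mathbb N\cup\{0\}$. The top of every absolutely cyclic $A$-module is isomorphic to $T$ or to $S$. Let $M$ be an absolutely cyclic $A$-module. (I) If the top of $M$ is isomorphic to $T$, then $M$ is isomorphic to the cokernel of exactly one of the following maps, in particular for a uniquely determined $k$: (a) $Q\xrightarrow{t^k}Q$ with $k\in\mathbb N$; the dimension vector is $(k,k)$. (b) $L\xrightarrow{t^k}Q$ with $k\in\mathbb N$; the dimension vector is $(k-1,k)$. (II) If the top of $M$ is isomorphic to $S$, then $M$ is isomorphic to the cokernel of one of the following maps. The type of the map (where the two maps in (c) count as two types) and the parameters $k$ and $l$ are uniquely determined by $M$. (a) $Q\oplus Q\xrightarrow{t^k\left(\begin{smallmatrix}1&0\\0&t^l\end{smallmatrix}\right)}P$ with $k,l\in\mathbb N_0$; the dimension vector is $(2k+l+1,2k+l)$.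 (b) $L\oplus L\xrightarrow{t^k\left(\begin{smallmatrix}1&0\\0&t^l\end{smallmatrix}\right)}P$ with $k\in\mathbb N$, $l\in\mathbb N_0$; the dimension vector is $(2k+l-1,2k+l)$. (c) $L\oplus Q\xrightarrow{t^k\left(\begin{smallmatrix}1&0\\0&t^l\end{smallmatrix}\right)}P$ with $k\in\mathbb N$, $l\in\mathbb N_0$, or $L\oplus Q\xrightarrow{t^k\left(\begin{smallmatrix}t^l&0\\0&1\end{smallmatrix}\right)}P$ with $k\in\mathbb N_0$, $l\in\mathbb N$; in both cases the dimension vector is $(2k+l,2k+l)$. (d) $P\xrightarrow{t^k\left(\begin{smallmatrix}1&0\\0&\lambda t^l\end{smallmatrix}\right)}P$ with $k\in\mathbb N$, $l\in\mathbb N_0$, $\lambda\in\mathbb R^*$; the dimension vector is $(2k+l,2k+l)$. Two such cokernels with parameters $(k,l,\lambda)$ and $(k',l',\lambda')$ are isomorphic if and only if $k=k'$, $l=l'$ and either $\lambda'=\lambda$, or $l=0$ and $\lambda'=\lambda^{-1}$. Hence $\lambda$ is unique if $l\ge1$, and it is unique if one requires $\lambda\in[-1,1]\setminus\{0\}$ when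 $l=0$. Conversely, every cokernel listed in (I) is absolutely cyclic with top isomorphic to $T$, and every cokernel listed in (II) is absolutely cyclic with top isomorphic to $S$. -/

import Mathlib

noncomputable section

open PowerSeries

namespace RealGelfand

/-- `R = ℝ⟦t⟧`; its maximal ideal `𝔪 = (t)` is the set of `p` with `constantCoeff p = 0`. -/
abbrev R : Type := PowerSeries ℝ

/-- The variable `t` of `R`. -/
abbrev t : R := PowerSeries.X

/-- The value `p(0)` of a power series. -/
abbrev ev (p : R) : ℝ := PowerSeries.constantCoeff p

/-- The real Gelfand order, with rows and columns numbered `0, 1, 2`: the `3 × 3` matrices over `R`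
with entries `(0,2)` and `(1,2)` in `𝔪` whose upper left `2 × 2` block is, modulo `𝔪`, of the form
`(α, -β; β, α)`. -/
def gelfandOrder : Subalgebra ℝ (Matrix (Fin 3) (Fin 3) R) where
  carrier := {a | ev (a 0 2) = 0 ∧ ev (a 1 2) = 0 ∧
    ev (a 0 0) = ev (a 1 1) ∧ ev (a 1 0) = - ev (a 0 1)}
  mul_mem' := by
    rintro a b ⟨ha1, ha2, ha3, ha4⟩ ⟨hb1, hb2, hb3, hb4⟩
    simp only [ev] at *
    refine ⟨?_, ?_, ?_, ?_⟩ <;>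
      simp [Matrix.mul_apply, Fin.sum_univ_three, ha1, ha2, ha3, ha4, hb1, hb2, hb3, hb4] <;> ring
  add_mem' := by
    rintro a b ⟨ha1, ha2, ha3, ha4⟩ ⟨hb1, hb2, hb3, hb4⟩
    simp only [ev] at *
    refine ⟨?_, ?_, ?_, ?_⟩ <;> simp [ha1, ha2, ha3, ha4, hb1, hb2, hb3, hb4] <;> ring
  algebraMap_mem' := by
    intro r
    refine ⟨?_, ?_, ?_, ?_⟩ <;> simp [ev, Matrix.algebraMap_matrix_apply]

/-- The real Gelfand order as a type. -/
def A : Type := gelfandOrder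

instance : Ring A := inferInstanceAs (Ring gelfandOrder)
instance : Algebra ℝ A := inferInstanceAs (Algebra ℝ gelfandOrder)

/-- The matrix of an element of `A`. -/
def mat (a : A) : Matrix (Fin 3) (Fin 3) R := Subtype.val (p := (· ∈ gelfandOrder)) a

theorem mat_mem (a : A) : ev (mat a 0 2) = 0 ∧ ev (mat a 1 2) = 0 ∧
    ev (mat a 0 0) = ev (mat a 1 1) ∧ ev (mat a 1 0) = - ev (mat a 0 1) :=
  Subtype.property (p := (· ∈ gelfandOrder)) a

theorem mat_one : mat 1 = 1 := rfl

theorem mat_zero : mat 0 = 0 := rfl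

theorem mat_add (a b : A) : mat (a + b) = mat a + mat b := rfl

theorem mat_mul (a b : A) : mat (a * b) = mat a * mat b := rfl

theorem mat_smul (r : ℝ) (a : A) : mat (r • a) = r • mat a := rfl

/-- The idempotent `e = diag(1, 1, 0)` of `A`. -/
def e : A := ⟨!![1, 0, 0; 0, 1, 0; 0, 0, 0], by
  refine ⟨?_, ?_, ?_, ?_⟩ <;> simp [ev]⟩

/-- The idempotent `f = diag(0, 0, 1)` of `A`. -/
def f : A := ⟨!![0, 0, 0; 0, 0, 0; 0, 0, 1], by
  refine ⟨?_, ?_, ?_, ?_⟩ <;> simp [ev]⟩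

/-! ### The two simple modules -/

/-- The ring homomorphism `A → ℂ`, `a ↦ α + iβ`, where `(α, -β; β, α)` is the upper left block
of `a` modulo `𝔪`. -/
def toC : A →+* ℂ where
  toFun a := ⟨ev (mat a 0 0), ev (mat a 1 0)⟩
  map_one' := by apply Complex.ext <;> simp [ev, mat_one]
  map_zero' := by apply Complex.ext <;> simp [ev, mat_zero]
  map_add' a b := by apply Complex.ext <;> simp [ev, mat_add]
  map_mul' := by
    intro a b
    obtain ⟨ha1, ha2, ha3, ha4⟩ := mat_mem a
    simp only [ev] at *
    apply Complex.ext
    · simp [mat_mul, Matrix.mul_apply, Fin.sum_univ_three, ha1, ha4]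
    · simp [mat_mul, Matrix.mul_apply, Fin.sum_univ_three, ha2, ha3]; ring

/-- The ring homomorphism `A → ℝ`, the lower right entry modulo `𝔪`. -/
def toR : A →+* ℝ where
  toFun a := ev (mat a 2 2)
  map_one' := by simp [ev, mat_one]
  map_zero' := by simp [ev, mat_zero]
  map_add' a b := by simp [ev, mat_add]
  map_mul' := by
    intro a b
    obtain ⟨hb1, hb2, hb3, hb4⟩ := mat_mem b
    simp only [ev] at *
    simp [mat_mul, Matrix.mul_apply, Fin.sum_univ_three, hb1, hb2]

/-- The simple module `S`, of dimension vector `(1, 0)`: the field `ℂ` with `A` acting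
through `A → ℂ`. -/
def S : Type := ℂ

instance : AddCommGroup S := inferInstanceAs (AddCommGroup ℂ)
instance : Module A S := Module.compHom ℂ toC

/-- The simple module `T`, of dimension vector `(0, 1)`: the field `ℝ` with `A` acting
through `A → ℝ`. -/
def T : Type := ℝ

instance : AddCommGroup T := inferInstanceAs (AddCommGroup ℝ)
instance : Module A T := Module.compHom ℝ toR

/-! ### Tops, absolutely cyclic modules, dimension vectors -/

/-- The top `M / rad M` of an `A`-module. -/
abbrev TopOf (M : Type*) [AddCommGroup M] [Module A M] : Type _ := M ⧸ Module.jacobson A M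

/-- `M` is an absolutely cyclic object of the category of finite dimensional `A`-modules:
it is finite dimensional and its top is simple. -/
structure IsAbsolutelyCyclic (M : Type*) [AddCommGroup M] [Module ℝ M] [Module A M]
    [IsScalarTower ℝ A M] : Prop where
  finite : Module.Finite ℝ M
  simple_top : IsSimpleModule A (TopOf M)

/-- `M` has dimension vector `d = (dim U, dim V)`, where `V = f M` and `e M ≅ U ⊕ U` as a
vector space over `ℝ` with complex structure, so that `dim_ℝ (e M) = 2 dim U`. -/
structure HasDimVector (M : Type*) [AddCommGroup M] [Module ℝ M] [Module A M]
    [IsScalarTower ℝ A M] (d : ℕ × ℕ) : Prop where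
  finite : Module.Finite ℝ M
  dim_e : Module.finrank ℝ (LinearMap.range (Algebra.lsmul ℝ ℝ M e)) = 2 * d.1
  dim_f : Module.finrank ℝ (LinearMap.range (Algebra.lsmul ℝ ℝ M f)) = d.2

/-! ### Lattices and their homomorphisms -/

/-- `3 × n` matrices over `R`, on which `A` acts by left multiplication. -/
def Mat (n : ℕ) : Type := Matrix (Fin 3) (Fin n) R

instance (n : ℕ) : AddCommGroup (Mat n) :=
  inferInstanceAs (AddCommGroup (Matrix (Fin 3) (Fin n) R))
instance (n : ℕ) : Module ℝ (Mat n) := inferInstanceAs (Module ℝ (Matrix (Fin 3) (Fin n) R))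

instance (n : ℕ) : Module A (Mat n) where
  smul a x := (mat a * (show Matrix (Fin 3) (Fin n) R from x) : Matrix (Fin 3) (Fin n) R)
  one_smul x := Matrix.one_mul (show Matrix (Fin 3) (Fin n) R from x)
  mul_smul a b x := Matrix.mul_assoc (mat a) (mat b) (show Matrix (Fin 3) (Fin n) R from x)
  smul_zero a := Matrix.mul_zero (mat a)
  smul_add a _ _ := Matrix.mul_add (mat a) _ _
  add_smul a b x := Matrix.add_mul (mat a) (mat b) (show Matrix (Fin 3) (Fin n) R from x)
  zero_smul x := Matrix.zero_mul (show Matrix (Fin 3) (Fin n) R from x)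

instance (n : ℕ) : IsScalarTower ℝ A (Mat n) where
  smul_assoc r a x := Matrix.smul_mul r (mat a) (show Matrix (Fin 3) (Fin n) R from x)

theorem smul_entry {n : ℕ} (a : A) (x : Mat n) (i : Fin 3) (j : Fin n) :
    (a • x) i j = mat a i 0 * x 0 j + mat a i 1 * x 1 j + mat a i 2 * x 2 j := by
  change ((mat a * (show Matrix (Fin 3) (Fin n) R from x) : Matrix (Fin 3) (Fin n) R)) i j = _
  rw [Matrix.mul_apply, Fin.sum_univ_three]

theorem add_entry {n : ℕ} (x y : Mat n) (i : Fin 3) (j : Fin n) :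
    (x + y) i j = x i j + y i j := rfl

theorem zero_entry {n : ℕ} (i : Fin 3) (j : Fin n) : (0 : Mat n) i j = 0 := rfl

/-- The lattice `L = [R; R; R]`. -/
def L : Submodule A (Mat 1) := ⊤

/-- The lattice `Q = A f = [𝔪; 𝔪; R]`. -/
def Q : Submodule A (Mat 1) where
  carrier := {x | ev (x 0 0) = 0 ∧ ev (x 1 0) = 0}
  zero_mem' := by constructor <;> simp [ev, zero_entry]
  add_mem' := by
    rintro x y ⟨hx1, hx2⟩ ⟨hy1, hy2⟩
    simp only [ev] at *
    constructor <;> simp [add_entry, hx1, hx2, hy1, hy2]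
  smul_mem' := by
    rintro a x ⟨hx1, hx2⟩
    obtain ⟨ha1, ha2, ha3, ha4⟩ := mat_mem a
    simp only [ev] at *
    constructor <;> simp [smul_entry, hx1, hx2, ha1, ha2]

/-- The lattice `P = A e`: the `3 × 2` matrices whose upper `2 × 2` block is, modulo `𝔪`, of the
form `(α, -β; β, α)`, with no condition on the last row. -/
def P : Submodule A (Mat 2) where
  carrier := {x | ev (x 0 0) = ev (x 1 1) ∧ ev (x 1 0) = - ev (x 0 1)}
  zero_mem' := by constructor <;> simp [ev, zero_entry]
  add_mem' := by
    rintro x y ⟨hx1, hx2⟩ ⟨hy1, hy2⟩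
    simp only [ev] at *
    constructor <;> simp [add_entry, hx1, hx2, hy1, hy2]; ring
  smul_mem' := by
    rintro a x ⟨hx1, hx2⟩
    obtain ⟨ha1, ha2, ha3, ha4⟩ := mat_mem a
    simp only [ev] at *
    constructor <;> simp [smul_entry, hx1, hx2, ha1, ha2, ha3, ha4]; ring

/-- The `j`-th column of a matrix, as a homomorphism of `A`-modules. -/
def col {n : ℕ} (j : Fin n) : Mat n →ₗ[A] Mat 1 where
  toFun x := fun i _ => x i j
  map_add' _ _ := rfl
  map_smul' a x := by
    funext i k
    exact (smul_entry a x i j).trans (smul_entry a (fun i _ => x i j : Mat 1) i k).symm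

/-- `F ⊕ G` for submodules `F, G` of `Mat 1`, realised as the `3 × 2` matrices with first column
in `F` and second column in `G`. -/
def dsum (F G : Submodule A (Mat 1)) : Submodule A (Mat 2) :=
  F.comap (col 0) ⊓ G.comap (col 1)

/-- Right multiplication by an `n × m` matrix, as a homomorphism of `A`-modules. -/
def rmul {n m : ℕ} (Z : Matrix (Fin n) (Fin m) R) : Mat n →ₗ[A] Mat m where
  toFun x := ((show Matrix (Fin 3) (Fin n) R from x) * Z : Matrix (Fin 3) (Fin m) R)
  map_add' x _ := Matrix.add_mul (show Matrix (Fin 3) (Fin n) R from x) _ Z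
  map_smul' a x := Matrix.mul_assoc (mat a) (show Matrix (Fin 3) (Fin n) R from x) Z

theorem rmul_entry {n m : ℕ} (Z : Matrix (Fin n) (Fin m) R) (x : Mat n) (i : Fin 3) (j : Fin m) :
    rmul Z x i j = ∑ s, x i s * Z s j := rfl

/-- The homomorphism `F → F'` given by right multiplication by `Z`. -/
def latticeMap {n m : ℕ} (F : Submodule A (Mat n)) (F' : Submodule A (Mat m))
    (Z : Matrix (Fin n) (Fin m) R) (h : ∀ x ∈ F, rmul Z x ∈ F') : F →ₗ[A] F' :=
  (rmul Z).restrict h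

/-- `t^k : Q → Q`. -/
def mapQQ (k : ℕ) : Q →ₗ[A] Q :=
  latticeMap Q Q !![t ^ k] (by
    rintro x ⟨h1, h2⟩
    simp only [ev] at *
    constructor <;> simp [rmul_entry, h1, h2])

/-- `t^k : L → Q`, for `k ≥ 1`. -/
def mapLQ (k : ℕ) (hk : 1 ≤ k) : L →ₗ[A] Q :=
  latticeMap L Q !![t ^ k] (by
    rintro x -
    have : k ≠ 0 := by omega
    constructor <;> simp [rmul_entry, this])

/-- `t^k · diag(1, t^l) : Q ⊕ Q → P`. -/
def mapQQP (k l : ℕ) : dsum Q Q →ₗ[A] P :=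
  latticeMap (dsum Q Q) P (t ^ k • !![1, 0; 0, t ^ l]) (by
    rintro x ⟨⟨h1, h2⟩, h3, h4⟩
    replace h1 : constantCoeff (x 0 0) = 0 := h1
    replace h2 : constantCoeff (x 1 0) = 0 := h2
    replace h3 : constantCoeff (x 0 1) = 0 := h3
    replace h4 : constantCoeff (x 1 1) = 0 := h4
    constructor <;> simp [rmul_entry, h1, h2, h3, h4])

/-- `t^k · diag(1, t^l) : L ⊕ L → P`, for `k ≥ 1`. -/
def mapLLP (k l : ℕ) (hk : 1 ≤ k) : dsum L L →ₗ[A] P :=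
  latticeMap (dsum L L) P (t ^ k • !![1, 0; 0, t ^ l]) (by
    rintro x -
    have : k ≠ 0 := by omega
    constructor <;> simp [rmul_entry, this])

/-- `t^k · diag(1, t^l) : L ⊕ Q → P`, for `k ≥ 1`. -/
def mapLQP (k l : ℕ) (hk : 1 ≤ k) : dsum L Q →ₗ[A] P :=
  latticeMap (dsum L Q) P (t ^ k • !![1, 0; 0, t ^ l]) (by
    rintro x -
    have : k ≠ 0 := by omega
    constructor <;> simp [rmul_entry, this])

/-- `t^k · diag(t^l, 1) : L ⊕ Q → P`, for `l ≥ 1`. -/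
def mapLQP' (k l : ℕ) (hl : 1 ≤ l) : dsum L Q →ₗ[A] P :=
  latticeMap (dsum L Q) P (t ^ k • !![t ^ l, 0; 0, 1]) (by
    rintro x ⟨-, h3, h4⟩
    have : l ≠ 0 := by omega
    replace h3 : constantCoeff (x 0 1) = 0 := h3
    replace h4 : constantCoeff (x 1 1) = 0 := h4
    constructor <;> simp [rmul_entry, this, h3, h4])

/-- `t^k · diag(1, c t^l) : P → P`, for `k ≥ 1`. -/
def mapPP (k l : ℕ) (c : ℝ) (hk : 1 ≤ k) : P →ₗ[A] P :=
  latticeMap P P (t ^ k • !![1, 0; 0, PowerSeries.C c * t ^ l]) (by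
    rintro x -
    have : k ≠ 0 := by omega
    constructor <;> simp [rmul_entry, this])

/-! ### The parameters of the normal forms -/

/-- The parameters of the maps into `Q`. -/
inductive FormT : Type
  | QQ (k : ℕ) (hk : 1 ≤ k)
  | LQ (k : ℕ) (hk : 1 ≤ k)

namespace FormT

/-- The image of the map with the given parameters. -/
def image : FormT → Submodule A Q
  | QQ k _ => LinearMap.range (mapQQ k)
  | LQ k hk => LinearMap.range (mapLQ k hk)

/-- The cokernel of the map with the given parameters. -/
abbrev Mod (p : FormT) : Type := Q ⧸ p.image

/-- The dimension vector of the cokernel. -/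
def dimVector : FormT → ℕ × ℕ
  | QQ k _ => (k, k)
  | LQ k _ => (k - 1, k)

end FormT

/-- The parameters of the maps into `P`. -/
inductive FormS : Type
  | QQ (k l : ℕ)
  | LL (k l : ℕ) (hk : 1 ≤ k)
  | LQ (k l : ℕ) (hk : 1 ≤ k)
  | LQ' (k l : ℕ) (hl : 1 ≤ l)
  | PP (k l : ℕ) (c : ℝ) (hk : 1 ≤ k) (hc : c ≠ 0)

namespace FormS

/-- The image of the map with the given parameters. -/
def image : FormS → Submodule A P
  | QQ k l => LinearMap.range (mapQQP k l)
  | LL k l hk => LinearMap.range (mapLLP k l hk)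
  | LQ k l hk => LinearMap.range (mapLQP k l hk)
  | LQ' k l hl => LinearMap.range (mapLQP' k l hl)
  | PP k l c hk _ => LinearMap.range (mapPP k l c hk)

/-- The cokernel of the map with the given parameters. -/
abbrev Mod (p : FormS) : Type := P ⧸ p.image

/-- The dimension vector of the cokernel. -/
def dimVector : FormS → ℕ × ℕ
  | QQ k l => (2 * k + l + 1, 2 * k + l)
  | LL k l _ => (2 * k + l - 1, 2 * k + l)
  | LQ k l _ => (2 * k + l, 2 * k + l)
  | LQ' k l _ => (2 * k + l, 2 * k + l)
  | PP k l _ _ _ => (2 * k + l, 2 * k + l)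

/-- The normalisation of the real parameter: it lies in `[-1, 1]` if `l = 0`. -/
def IsNormalized : FormS → Prop
  | PP _ l c _ _ => l = 0 → c ∈ Set.Icc (-1 : ℝ) 1
  | _ => True

end FormS

end RealGelfand

end

noncomputable section

open PowerSeries

namespace RealGelfand

/-! ### Elements of the order -/

/-! The radical of an absolutely cyclic module `M` is its greatest proper submodule, so any element
outside it generates `M`. Since `1 = e + f`, a generator can be chosen in `e M` or in `f M`, and `M`
is a quotient of `P = A e` or of `Q = A f`. Both are local, with tops `S` and `T` (`le_ker_topP`,
`le_ker_topQ`). The task is to classify submodules `N` of finite codimension up to automorphisms of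
`P` or `Q`.

Such an `N`, inside the `3 × n` matrices, is linear algebra. Let `V` be the `R`-lattice of those
rows `v` for which the matrix with last row `v` and zeros elsewhere lies in `N`. Matrix units move
any row to the last row, and `t` times a matrix unit moves the last row up. Hence all rows of
elements of `N` lie in `V`, and `N` contains every matrix with upper rows in `t V` and last row in
`V`. What remains is the set of pairs of upper rows in `V / t V`; read as real and imaginary parts,
they form a complex subspace `W`, because `A` acts on them through `A → ℂ`. If `V` has the basis `t
^ d j`, then `N = diagLattice d W` (`exists_eq_diagLattice`). All the given lattices are of this
kind with `d = 0`; for instance `P` belongs to the line through `(1, i)`.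

For `Q`, `W` is `0` or `ℂ`, which gives the two families with top `T`. For `P`, automorphisms are
right multiplications by invertible `Y` whose constant part is `(α, -β; β, α)`. A sum of two real
squares vanishes only trivially, so rotations over `R` suffice to diagonalise `V`, with exponents
`k, k + l` (`exists_rightEquiv_rows`). If `W` is a line and `l = 0`, real rotations make its two
coordinates orthogonal in the plane, so `W` becomes the line through `(1, iμ)` with `|μ| ≤ 1`. If `l
≥ 1`, shears remove the real part of `z` in `(1, z)`, and `(0, 1)` is left over. The value `μ = 0`
is the cokernel of `L ⊕ Q`, and `μ = λ ≠ 0` that of `P`.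

For uniqueness, an isomorphism of cokernels lifts to an endomorphism of `P`
(`exists_isEndP_of_equiv`). It determines `k`, the dimension vector then determines `l`, and the
induced real action on `W` (`subspace_action`) fixes `μ`, up to inversion when `l = 0`
(`FormS.line_rigid`). -/

theorem Mat.ext {n : ℕ} {x y : Mat n} (h : ∀ i j, x i j = y i j) : x = y :=
  funext fun i => funext fun j => h i j

theorem A.ext {a b : A} (h : ∀ i j, mat a i j = mat b i j) : a = b :=
  Subtype.ext (Matrix.ext h)

theorem sub_entry {n : ℕ} (x y : Mat n) (i : Fin 3) (j : Fin n) :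
    (x - y) i j = x i j - y i j := rfl

theorem real_smul_entry {n : ℕ} (r : ℝ) (x : Mat n) (i : Fin 3) (j : Fin n) :
    (r • x) i j = r • x i j := rfl

/-- The matrix with the single entry `r`, in position `(i, j)`. -/
def single (i j : Fin 3) (r : R) (h : i = 2 ∨ ev r = 0) : A :=
  ⟨Matrix.single i j r, by
    refine ⟨?_, ?_, ?_, ?_⟩ <;> rcases h with rfl | h <;>
      simp only [ev, Matrix.single_apply] at * <;> split_ifs <;> simp_all⟩

theorem single_smul_entry {n : ℕ} (i j : Fin 3) (r : R) (h : i = 2 ∨ ev r = 0) (x : Mat n)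
    (i' : Fin 3) (k : Fin n) :
    (single i j r h • x) i' k = if i = i' then r * x j k else 0 := by
  have h0 : mat (single i j r h) = Matrix.single i j r := rfl
  rw [smul_entry, h0]
  simp only [Matrix.single_apply]
  by_cases hi : i = i'
  · fin_cases j <;> simp [hi]
  · simp [hi]

/-- The scalar matrices in `A`. -/
def scalar : R →ₐ[ℝ] A where
  toFun r := ⟨Matrix.scalar (Fin 3) r, by
    refine ⟨?_, ?_, ?_, ?_⟩ <;> simp [ev, Matrix.scalar_apply]⟩
  map_one' := Subtype.ext (map_one (Matrix.scalar (Fin 3)))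
  map_mul' r s := Subtype.ext (map_mul (Matrix.scalar (Fin 3)) r s)
  map_zero' := Subtype.ext (map_zero (Matrix.scalar (Fin 3)))
  map_add' r s := Subtype.ext (map_add (Matrix.scalar (Fin 3)) r s)
  commutes' r := Subtype.ext rfl

theorem scalar_smul_entry {n : ℕ} (r : R) (x : Mat n) (i : Fin 3) (j : Fin n) :
    (scalar r • x) i j = r * x i j := by
  have h0 : mat (scalar r) = Matrix.scalar (Fin 3) r := rfl
  rw [smul_entry, h0]
  fin_cases i <;> simp [Matrix.scalar_apply]

/-- The constant matrix with upper left block `(α, -β; β, α)` and zeros elsewhere,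
for `z = α + iβ`. -/
def ofComplex (z : ℂ) : A :=
  ⟨!![C z.re, - C z.im, 0; C z.im, C z.re, 0; 0, 0, 0], by
    refine ⟨?_, ?_, ?_, ?_⟩ <;> simp [ev]⟩

theorem toC_ofComplex (z : ℂ) : toC (ofComplex z) = z := by
  apply Complex.ext
  · change ev (C z.re) = _
    simp [ev]
  · change ev (C z.im) = _
    simp [ev]

theorem e_smul_entry {n : ℕ} (x : Mat n) (i : Fin 3) (j : Fin n) :
    (e • x) i j = if i = 2 then 0 else x i j := by
  rw [smul_entry]
  have h0 : mat e = !![1, 0, 0; 0, 1, 0; 0, 0, 0] := rfl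
  rw [h0]
  fin_cases i <;> simp

theorem f_smul_entry {n : ℕ} (x : Mat n) (i : Fin 3) (j : Fin n) :
    (f • x) i j = if i = 2 then x i j else 0 := by
  rw [smul_entry]
  have h0 : mat f = !![0, 0, 0; 0, 0, 0; 0, 0, 1] := rfl
  rw [h0]
  fin_cases i <;> simp

theorem e_add_f : e + f = 1 := by
  apply A.ext
  intro i j
  have h0 : mat e = !![1, 0, 0; 0, 1, 0; 0, 0, 0] := rfl
  have h1 : mat f = !![0, 0, 0; 0, 0, 0; 0, 0, 1] := rfl
  rw [mat_add, mat_one, h0, h1]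
  fin_cases i <;> fin_cases j <;> simp

theorem e_mul_e : e * e = e := by
  apply A.ext
  intro i j
  have h0 : mat e = !![1, 0, 0; 0, 1, 0; 0, 0, 0] := rfl
  rw [mat_mul, h0, Matrix.mul_apply, Fin.sum_univ_three]
  fin_cases i <;> fin_cases j <;> simp

theorem f_mul_f : f * f = f := by
  apply A.ext
  intro i j
  have h0 : mat f = !![0, 0, 0; 0, 0, 0; 0, 0, 1] := rfl
  rw [mat_mul, h0, Matrix.mul_apply, Fin.sum_univ_three]
  fin_cases i <;> fin_cases j <;> simp

/-! ### Lattices given by a complex subspace -/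

/-- The upper two rows modulo `𝔪`, combined to a complex vector. -/
def residue {n : ℕ} (w : Mat n) : Fin n → ℂ := fun j => ⟨ev (w 0 j), ev (w 1 j)⟩

theorem residue_add {n : ℕ} (x y : Mat n) : residue (x + y) = residue x + residue y := by
  funext j
  apply Complex.ext <;> simp [residue, add_entry]

theorem residue_sub {n : ℕ} (x y : Mat n) : residue (x - y) = residue x - residue y := by
  funext j
  apply Complex.ext <;> simp [residue, sub_entry]

theorem residue_zero {n : ℕ} : residue (0 : Mat n) = 0 := by
  funext j
  apply Complex.ext <;> simp [residue, zero_entry]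

/-- Modulo `𝔪` the upper rows of `a` ignore the last row of `x`, and the block `(α, -β; β, α)` acts
on a plane vector as multiplication by `α + iβ`. -/
theorem residue_smul {n : ℕ} (a : A) (x : Mat n) : residue (a • x) = toC a • residue x := by
  obtain ⟨ha1, ha2, ha3, ha4⟩ := mat_mem a
  simp only [ev] at *
  funext j
  have h0 : (toC a).re = ev (mat a 0 0) := rfl
  have h1 : (toC a).im = ev (mat a 1 0) := rfl
  apply Complex.ext <;>
    simp [residue, smul_entry, h0, h1, ha1, ha2, ha3, ha4, Complex.mul_re, Complex.mul_im]
  ring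

/-- A matrix with prescribed residue. -/
def lift {n : ℕ} (u : Fin n → ℂ) : Mat n :=
  fun i j => if i = 0 then C (u j).re else if i = 1 then C (u j).im else 0

theorem residue_lift {n : ℕ} (u : Fin n → ℂ) : residue (lift u) = u := by
  funext j
  apply Complex.ext <;> simp [residue, lift]

/-- The lattice of matrices whose residue lies in a given complex subspace. -/
def residueLattice {n : ℕ} (W : Submodule ℂ (Fin n → ℂ)) : Submodule A (Mat n) where
  carrier := {w | residue w ∈ W}
  zero_mem' := by simp [residue_zero]
  add_mem' := by
    intro x y hx hy
    simp only [Set.mem_ofPred_eq, residue_add] at *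
    exact W.add_mem hx hy
  smul_mem' := by
    intro a x hx
    simp only [Set.mem_ofPred_eq, residue_smul] at *
    exact W.smul_mem _ hx

theorem mem_residueLattice {n : ℕ} {W : Submodule ℂ (Fin n → ℂ)} {w : Mat n} :
    w ∈ residueLattice W ↔ residue w ∈ W := Iff.rfl

/-- The diagonal matrix with entries `t ^ d j`. -/
def diag {n : ℕ} (d : Fin n → ℕ) : Matrix (Fin n) (Fin n) R := Matrix.diagonal fun j => t ^ d j

theorem rmul_diag_entry {n : ℕ} (d : Fin n → ℕ) (x : Mat n) (i : Fin 3) (j : Fin n) :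
    rmul (diag d) x i j = x i j * t ^ d j := by
  rw [rmul_entry]
  simp [diag, Matrix.diagonal_apply]

theorem rmul_rmul {n m p : ℕ} (Y : Matrix (Fin n) (Fin m) R) (Z : Matrix (Fin m) (Fin p) R)
    (x : Mat n) : rmul Z (rmul Y x) = rmul (Y * Z) x :=
  Matrix.mul_assoc (show Matrix (Fin 3) (Fin n) R from x) Y Z

theorem rmul_one {n : ℕ} (x : Mat n) : rmul 1 x = x :=
  Matrix.mul_one (show Matrix (Fin 3) (Fin n) R from x)

theorem map_rmul_map_rmul {n m p : ℕ} (F : Submodule A (Mat n)) (Y : Matrix (Fin n) (Fin m) R)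
    (Z : Matrix (Fin m) (Fin p) R) : (F.map (rmul Y)).map (rmul Z) = F.map (rmul (Y * Z)) := by
  rw [← Submodule.map_comp]
  congr 1
  exact LinearMap.ext (rmul_rmul Y Z)

/-- The lattice `residueLattice W`, multiplied from the right by a diagonal matrix. -/
def diagLattice {n : ℕ} (d : Fin n → ℕ) (W : Submodule ℂ (Fin n → ℂ)) : Submodule A (Mat n) :=
  (residueLattice W).map (rmul (diag d))

theorem mem_diagLattice {n : ℕ} {d : Fin n → ℕ} {W : Submodule ℂ (Fin n → ℂ)} {x : Mat n} :
    x ∈ diagLattice d W ↔ ∃ w, residue w ∈ W ∧ rmul (diag d) w = x := Iff.rfl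

/-- The matrix with last row `v` and zeros elsewhere. -/
def lastRow {n : ℕ} (v : Fin n → R) : Mat n := fun i j => if i = 2 then v j else 0

theorem lastRow_entry {n : ℕ} (v : Fin n → R) (i : Fin 3) (j : Fin n) :
    lastRow v i j = if i = 2 then v j else 0 := rfl

theorem residue_lastRow {n : ℕ} (v : Fin n → R) : residue (lastRow v) = 0 := by
  funext j
  apply Complex.ext <;> simp [residue, lastRow]

theorem rmul_lastRow {n m : ℕ} (Y : Matrix (Fin n) (Fin m) R) (v : Fin n → R) :
    rmul Y (lastRow v) = lastRow (Matrix.vecMul v Y) := by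
  apply Mat.ext
  intro i j
  rw [rmul_entry]
  by_cases h : i = 2 <;> simp [lastRow, h, Matrix.vecMul, dotProduct]

/-- The last row of an element of `A` is unrestricted, so the matrix unit in position `(2, i)`
belongs to `A`. -/
theorem lastRow_mem_of_mem {n : ℕ} {N : Submodule A (Mat n)} {x : Mat n} (hx : x ∈ N) (i : Fin 3) :
    lastRow (x i) ∈ N := by
  have := N.smul_mem (single 2 i 1 (Or.inl rfl)) hx
  convert this using 1
  apply Mat.ext
  intro i' j
  rw [single_smul_entry, lastRow_entry]
  simp [eq_comm]

/-- A submodule whose last rows form the lattice with basis `t ^ d j` is determined by a complex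
subspace. -/
theorem exists_eq_diagLattice {n : ℕ} (N : Submodule A (Mat n)) (d : Fin n → ℕ)
    (hV : ∀ v : Fin n → R, lastRow v ∈ N ↔ ∀ j, t ^ d j ∣ v j) :
    ∃ W, N = diagLattice d W := by
  let W : Submodule ℂ (Fin n → ℂ) :=
    { carrier := {u | ∃ w, rmul (diag d) w ∈ N ∧ residue w = u}
      zero_mem' := ⟨0, by simp, residue_zero⟩
      add_mem' := by
        rintro _ _ ⟨x, hx, rfl⟩ ⟨y, hy, rfl⟩
        exact ⟨x + y, by rw [map_add]; exact N.add_mem hx hy, residue_add _ _⟩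
      smul_mem' := by
        rintro z _ ⟨x, hx, rfl⟩
        exact ⟨ofComplex z • x, by rw [map_smul]; exact N.smul_mem _ hx,
          by rw [residue_smul, toC_ofComplex]⟩ }
  refine ⟨W, le_antisymm ?_ ?_⟩
  · intro x hx
    have h : ∀ i j, ∃ w, x i j = t ^ d j * w := fun i j => (hV _).1 (lastRow_mem_of_mem hx i) j
    obtain ⟨w, hw⟩ : ∃ w : Mat n, ∀ i j, x i j = t ^ d j * w i j :=
      ⟨fun i j => (h i j).choose, fun i j => (h i j).choose_spec⟩
    have hwx : rmul (diag d) w = x := by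
      apply Mat.ext
      intro i j
      rw [rmul_diag_entry, hw, mul_comm]
    exact mem_diagLattice.2 ⟨w, ⟨w, by rwa [hwx], rfl⟩, hwx⟩
  · rintro _ ⟨w, ⟨w', hw', hr⟩, rfl⟩
    -- Membership depends on the residue only: `w - w'` has upper rows in `𝔪`, and such matrices,
    -- multiplied by `diag d`, all lie in `N`.
    have hy : residue (w - w') = 0 := by rw [residue_sub, hr, sub_self]
    have h : ∀ i : Fin 3, ∀ j, i ≠ 2 → ∃ z, (w - w') i j = t * z := by
      intro i j hi
      apply X_dvd_iff.2
      have h1 := congrFun hy j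
      fin_cases i
      · exact congrArg Complex.re h1
      · exact congrArg Complex.im h1
      · exact absurd rfl hi
    have key : rmul (diag d) (w - w') ∈ N := by
      choose! z hz using h
      have hmem : ∀ v : Fin n → R, lastRow (fun j => v j * t ^ d j) ∈ N := fun v =>
        (hV _).2 fun j => Dvd.intro_left _ rfl
      -- `A` contains `t` times the matrix units in positions `(0, 2)` and `(1, 2)`. They turn last
      -- rows in `N` into upper rows divisible by one more power of `t`.
      have := N.add_mem (N.add_mem
        (N.smul_mem (single 0 2 t (Or.inr (by simp [ev]))) (hmem (z 0)))
        (N.smul_mem (single 1 2 t (Or.inr (by simp [ev]))) (hmem (z 1))))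
        (hmem ((w - w') 2))
      convert this using 1
      apply Mat.ext
      intro i j
      rw [rmul_diag_entry, add_entry, add_entry, single_smul_entry, single_smul_entry]
      simp only [lastRow_entry]
      fin_cases i
      · simp [hz 0 j (by decide), mul_assoc]
      · simp [hz 1 j (by decide), mul_assoc]
      · simp
    have h2 := N.add_mem key hw'
    rwa [← map_add, sub_add_cancel] at h2

/-- The action of a matrix over `R` on complex row vectors, through its constant coefficients. -/
def residueAct {n : ℕ} (Y : Matrix (Fin n) (Fin n) R) : (Fin n → ℂ) →ₗ[ℂ] (Fin n → ℂ) :=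
  Matrix.vecMulLinear (Y.map fun p => (ev p : ℂ))

theorem residueAct_apply {n : ℕ} (Y : Matrix (Fin n) (Fin n) R) (u : Fin n → ℂ) (j : Fin n) :
    residueAct Y u j = ∑ s, u s * (ev (Y s j) : ℂ) := rfl

theorem residue_rmul {n : ℕ} (Y : Matrix (Fin n) (Fin n) R) (w : Mat n) :
    residue (rmul Y w) = residueAct Y (residue w) := by
  funext j
  rw [residueAct_apply]
  apply Complex.ext
  · simp [residue, rmul_entry, Complex.re_sum]
  · simp [residue, rmul_entry, Complex.im_sum]

theorem map_rmul_residueLattice {n : ℕ} (W : Submodule ℂ (Fin n → ℂ))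
    {Y Y' : Matrix (Fin n) (Fin n) R} (h : Y * Y' = 1) :
    (residueLattice W).map (rmul Y) = residueLattice (W.map (residueAct Y)) := by
  have h' : Y' * Y = 1 := mul_eq_one_comm.1 h
  apply le_antisymm
  · rintro _ ⟨w, hw, rfl⟩
    exact ⟨residue w, hw, (residue_rmul Y w).symm⟩
  · rintro x ⟨u, hu, hx⟩
    refine ⟨rmul Y' x, ?_, by rw [rmul_rmul, h', rmul_one]⟩
    change residue _ ∈ W
    have : u = residue (rmul Y' x) := by
      rw [residue_rmul, ← hx, ← residue_lift u, ← residue_rmul, ← residue_rmul, rmul_rmul, h,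
        rmul_one]
    rwa [← this]

/-! ### Dimension vectors -/

section Dimension

variable {X : Type*} [AddCommGroup X] [Module ℝ X] [Module A X] [IsScalarTower ℝ A X]

theorem HasDimVector.of_equiv {M M' : Type*} [AddCommGroup M] [Module ℝ M] [Module A M]
    [IsScalarTower ℝ A M] [AddCommGroup M'] [Module ℝ M'] [Module A M'] [IsScalarTower ℝ A M']
    {d : ℕ × ℕ} (h : HasDimVector M d) (φ : M ≃ₗ[A] M') : HasDimVector M' d := by
  have key : ∀ a : A, Module.finrank ℝ (LinearMap.range (Algebra.lsmul ℝ ℝ M' a)) =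
      Module.finrank ℝ (LinearMap.range (Algebra.lsmul ℝ ℝ M a)) := by
    intro a
    have : LinearMap.range (Algebra.lsmul ℝ ℝ M' a) =
        (LinearMap.range (Algebra.lsmul ℝ ℝ M a)).map
          ((φ.restrictScalars ℝ : M ≃ₗ[ℝ] M') : M →ₗ[ℝ] M') := by
      ext y
      constructor
      · rintro ⟨x, rfl⟩
        exact ⟨a • φ.symm x, ⟨φ.symm x, rfl⟩, by simp⟩
      · rintro ⟨_, ⟨x, rfl⟩, rfl⟩
        exact ⟨φ x, by simp⟩
    rw [this, LinearEquiv.finrank_map_eq]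
  have := h.finite
  exact ⟨Module.Finite.equiv (φ.restrictScalars ℝ), (key e).trans h.dim_e, (key f).trans h.dim_f⟩

/-- The image of `a` on a quotient is the image of any linear map with the same kernel. -/
theorem nonempty_range_lsmul_equiv {Y : Type*} [AddCommGroup Y] [Module ℝ Y] (a : A)
    (N : Submodule A X) (ψ : X →ₗ[ℝ] Y) (h : ∀ x, ψ x = 0 ↔ a • x ∈ N) :
    Nonempty (LinearMap.range (Algebra.lsmul ℝ ℝ (X ⧸ N) a) ≃ₗ[ℝ] LinearMap.range ψ) := by
  let g : X →ₗ[ℝ] X ⧸ N := (Algebra.lsmul ℝ ℝ (X ⧸ N) a).comp (N.mkQ.restrictScalars ℝ)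
  have hg : LinearMap.range g = LinearMap.range (Algebra.lsmul ℝ ℝ (X ⧸ N) a) :=
    LinearMap.range_comp_of_range_eq_top _ (LinearMap.range_eq_top.2 N.mkQ_surjective)
  have hk : LinearMap.ker g = LinearMap.ker ψ := by
    ext x
    rw [LinearMap.mem_ker, LinearMap.mem_ker, h]
    exact Submodule.Quotient.mk_eq_zero N (x := a • x)
  rw [← hg]
  exact ⟨g.quotKerEquivRange.symm.trans
    ((Submodule.quotEquivOfEq _ _ hk).trans ψ.quotKerEquivRange)⟩

/-- The dimension of the image of an idempotent on `F / N`, for `N ≤ F ≤ X`. -/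
theorem finrank_range_lsmul_quotient {Y Y' : Type*} [AddCommGroup Y] [Module ℝ Y]
    [AddCommGroup Y'] [Module ℝ Y'] [Module.Finite ℝ Y] (a : A) (ha : a * a = a)
    (N F : Submodule A X) (hNF : N ≤ F)
    (ψ : X →ₗ[ℝ] Y) (hψ : Function.Surjective ψ) (h : ∀ x, ψ x = 0 ↔ a • x ∈ N)
    (ψ' : X →ₗ[ℝ] Y') (hψ' : Function.Surjective ψ') (h' : ∀ x, ψ' x = 0 ↔ a • x ∈ F) :
    Module.Finite ℝ (LinearMap.range (Algebra.lsmul ℝ ℝ (F ⧸ N.submoduleOf F) a)) ∧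
    Module.finrank ℝ (LinearMap.range (Algebra.lsmul ℝ ℝ (F ⧸ N.submoduleOf F) a)) +
      Module.finrank ℝ Y' = Module.finrank ℝ Y := by
  obtain ⟨E⟩ := nonempty_range_lsmul_equiv a (N.submoduleOf F)
    (ψ.comp (F.subtype.restrictScalars ℝ)) (fun x => h x)
  refine ⟨Module.Finite.equiv E.symm, ?_⟩
  rw [E.finrank_eq]
  have hker : LinearMap.ker ψ ≤ LinearMap.ker ψ' := by
    intro x hx
    exact (h' x).2 (hNF ((h x).1 hx))
  -- In coordinates this is the surjection `aX / aN → aX / aF`. Its kernel is `aF / aN`, so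
  -- rank-nullity gives the count.
  let g : Y →ₗ[ℝ] Y' := (LinearMap.ker ψ).liftQ ψ' hker ∘ₗ
    (ψ.quotKerEquivOfSurjective hψ).symm.toLinearMap
  have hg : ∀ x, g (ψ x) = ψ' x := by
    intro x
    have : (ψ.quotKerEquivOfSurjective hψ).symm (ψ x) = (LinearMap.ker ψ).mkQ x := by
      rw [LinearEquiv.symm_apply_eq]
      rfl
    simp [g, this]
  have hgs : Function.Surjective g := fun y => by
    obtain ⟨x, rfl⟩ := hψ' y
    exact ⟨ψ x, hg x⟩
  have hgk : LinearMap.ker g = LinearMap.range (ψ.comp (F.subtype.restrictScalars ℝ)) := by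
    ext y
    constructor
    · intro hy
      obtain ⟨x, rfl⟩ := hψ y
      rw [LinearMap.mem_ker, hg, h'] at hy
      refine ⟨⟨a • x, hy⟩, ?_⟩
      change ψ (a • x) = ψ x
      rw [← sub_eq_zero, ← map_sub, h, smul_sub, ← mul_smul, ha, sub_self]
      exact N.zero_mem
    · rintro ⟨x, rfl⟩
      change g (ψ x) = 0
      rw [hg, h']
      exact F.smul_mem _ x.2
  rw [← hgk, ← g.finrank_range_add_finrank_ker, LinearMap.range_eq_top.2 hgs, finrank_top, add_comm]

end Dimension

/-! ### Codimensions of the lattices, counted by coefficients -/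

theorem t_pow_dvd_iff {m : ℕ} {p : R} : t ^ m ∣ p ↔ ∀ i < m, coeff i p = 0 := X_pow_dvd_iff

/-- The coefficients which detect whether the last row of a matrix lies in `diagLattice d W`. -/
def lastRowCoeffs {n : ℕ} (d : Fin n → ℕ) : Mat n →ₗ[ℝ] ((j : Fin n) → Fin (d j) → ℝ) where
  toFun x j m := coeff m (x 2 j)
  map_add' x y := by funext j m; simp [add_entry]
  map_smul' r x := by funext j m; simp [real_smul_entry]

/-- The coefficients which detect whether the upper rows of a matrix lie in `diagLattice d W`. -/
def upperCoeffs {n : ℕ} (d : Fin n → ℕ) (W : Submodule ℂ (Fin n → ℂ)) :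
    Mat n →ₗ[ℝ] (((j : Fin n) → Fin (d j) → ℂ) × ((Fin n → ℂ) ⧸ W)) where
  toFun x := (fun j m => ⟨coeff m (x 0 j), coeff m (x 1 j)⟩,
    W.mkQ fun j => ⟨coeff (d j) (x 0 j), coeff (d j) (x 1 j)⟩)
  map_add' x y := by
    refine Prod.ext ?_ ?_
    · funext j m
      apply Complex.ext <;> simp [add_entry]
    · dsimp only [Prod.snd_add]
      rw [← map_add]
      congr 1
  map_smul' r x := by
    refine Prod.ext ?_ ?_
    · funext j m
      apply Complex.ext <;> simp [real_smul_entry]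
    · dsimp only [Prod.smul_snd, RingHom.id_apply]
      rw [← LinearMap.map_smul_of_tower]
      congr 1
      funext j
      apply Complex.ext <;> simp [real_smul_entry]

theorem lastRowCoeffs_surjective {n : ℕ} (d : Fin n → ℕ) :
    Function.Surjective (lastRowCoeffs d) := by
  intro y
  refine ⟨lastRow fun j => PowerSeries.mk fun m => if h : m < d j then y j ⟨m, h⟩ else 0, ?_⟩
  funext j m
  simp [lastRowCoeffs, lastRow]

theorem upperCoeffs_surjective {n : ℕ} (d : Fin n → ℕ) (W : Submodule ℂ (Fin n → ℂ)) :
    Function.Surjective (upperCoeffs d W) := by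
  rintro ⟨y, z⟩
  obtain ⟨z, rfl⟩ := W.mkQ_surjective z
  -- Coefficients below degree `d j` are prescribed by `y`, the one in degree `d j` by `z`; the
  -- higher ones do not matter.
  let q : Fin n → ℕ → ℂ := fun j m => if h : m < d j then y j ⟨m, h⟩ else z j
  refine ⟨fun i j => if i = 0 then PowerSeries.mk fun m => (q j m).re
    else PowerSeries.mk fun m => (q j m).im, ?_⟩
  refine Prod.ext ?_ ?_
  · funext j m
    apply Complex.ext <;> simp [upperCoeffs, q]
  · simp only [upperCoeffs, LinearMap.coe_mk, AddHom.coe_mk]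
    congr 1
    funext j
    apply Complex.ext <;> simp [q]

theorem lastRowCoeffs_eq_zero_iff {n : ℕ} (d : Fin n → ℕ) (W : Submodule ℂ (Fin n → ℂ))
    (x : Mat n) : lastRowCoeffs d x = 0 ↔ f • x ∈ diagLattice d W := by
  constructor
  · intro h
    have h' : ∀ j, t ^ d j ∣ x 2 j := fun j => t_pow_dvd_iff.2 fun m hm =>
      congrFun (congrFun h j) ⟨m, hm⟩
    choose w hw using h'
    refine mem_diagLattice.2 ⟨lastRow w, by rw [residue_lastRow]; exact W.zero_mem, ?_⟩
    apply Mat.ext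
    intro i j
    rw [rmul_diag_entry, f_smul_entry, lastRow_entry]
    by_cases hi : i = 2
    · subst hi
      simp [hw, mul_comm]
    · simp [hi]
  · rintro ⟨w, -, hw⟩
    funext j m
    have h2 : x 2 j = w 2 j * t ^ d j := by
      rw [← rmul_diag_entry, hw, f_smul_entry]
      simp
    change coeff m (x 2 j) = 0
    exact t_pow_dvd_iff.1 (Dvd.intro_left _ h2.symm) m m.2

theorem upperCoeffs_eq_zero_iff {n : ℕ} (d : Fin n → ℕ) (W : Submodule ℂ (Fin n → ℂ))
    (x : Mat n) : upperCoeffs d W x = 0 ↔ e • x ∈ diagLattice d W := by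
  constructor
  · intro h
    have h1 := congrArg Prod.fst h
    have h2 := congrArg Prod.snd h
    replace h2 := (Submodule.Quotient.mk_eq_zero W).1 h2
    have h' : ∀ (i : Fin 3) (j : Fin n), ∃ w, (if i = 2 then 0 else x i j) = t ^ d j * w := by
      intro i j
      refine t_pow_dvd_iff.2 fun m hm => ?_
      have h3 := congrFun (congrFun h1 j) ⟨m, hm⟩
      fin_cases i
      · exact congrArg Complex.re h3
      · exact congrArg Complex.im h3
      · simp
    obtain ⟨w, hw⟩ : ∃ w : Mat n, ∀ i j, (if i = 2 then 0 else x i j) = t ^ d j * w i j :=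
      ⟨fun i j => (h' i j).choose, fun i j => (h' i j).choose_spec⟩
    refine mem_diagLattice.2 ⟨w, ?_, ?_⟩
    · convert h2 using 1
      funext j
      have h0 := hw 0 j
      have h1 := hw 1 j
      simp only [Fin.isValue, Fin.reduceEq, if_false] at h0 h1
      rw [h0, h1]
      apply Complex.ext <;> simp [residue, coeff_X_pow_mul']
    · apply Mat.ext
      intro i j
      rw [rmul_diag_entry, e_smul_entry, hw, mul_comm]
  · rintro ⟨w, hr, hw⟩
    have h' : ∀ i j, i ≠ 2 → x i j = w i j * t ^ d j := by
      intro i j hi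
      rw [← rmul_diag_entry, hw, e_smul_entry, if_neg hi]
    refine Prod.ext ?_ ?_
    · funext j m
      have := m.2
      apply Complex.ext <;> simp [upperCoeffs, h', coeff_mul_X_pow']
    · refine (Submodule.Quotient.mk_eq_zero W).2 ?_
      replace hr : residue w ∈ W := hr
      convert hr using 1
      funext j
      apply Complex.ext <;> simp [residue, h', coeff_mul_X_pow']

theorem finrank_upperCoeffs_codomain {n : ℕ} (d : Fin n → ℕ) (W : Submodule ℂ (Fin n → ℂ)) :
    Module.finrank ℝ (((j : Fin n) → Fin (d j) → ℂ) × ((Fin n → ℂ) ⧸ W)) +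
      2 * Module.finrank ℂ W = 2 * (∑ j, d j + n) := by
  have h1 := Submodule.finrank_quotient_add_finrank W
  rw [Module.finrank_fin_fun] at h1
  have h2 := finrank_real_of_complex ((Fin n → ℂ) ⧸ W)
  rw [Module.finrank_prod, h2, Module.finrank_pi_fintype]
  simp only [Module.finrank_pi_fintype, Complex.finrank_real_complex, Finset.sum_const,
    Finset.card_univ, Fintype.card_fin, smul_eq_mul, ← Finset.sum_mul]
  omega

theorem diagLattice_zero {n : ℕ} (W : Submodule ℂ (Fin n → ℂ)) :
    diagLattice (fun _ => 0) W = residueLattice W := by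
  have : (diag fun _ : Fin n => 0) = 1 := by simp [diag]
  rw [diagLattice, this]
  ext x
  constructor
  · rintro ⟨w, hw, rfl⟩
    rwa [rmul_one]
  · intro hx
    exact ⟨x, hx, rmul_one x⟩

theorem finite_of_range_lsmul {M : Type*} [AddCommGroup M] [Module ℝ M] [Module A M]
    [IsScalarTower ℝ A M] (he : Module.Finite ℝ (LinearMap.range (Algebra.lsmul ℝ ℝ M e)))
    (hf : Module.Finite ℝ (LinearMap.range (Algebra.lsmul ℝ ℝ M f))) : Module.Finite ℝ M := by
  have : LinearMap.range (Algebra.lsmul ℝ ℝ M e) ⊔ LinearMap.range (Algebra.lsmul ℝ ℝ M f) = ⊤ := by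
    rw [eq_top_iff]
    intro x _
    have hx : e • x + f • x = x := by rw [← add_smul, e_add_f, one_smul]
    rw [← hx]
    exact Submodule.add_mem_sup ⟨x, rfl⟩ ⟨x, rfl⟩
  rw [Module.finite_def, ← this]
  exact Submodule.FG.sup (Module.Finite.iff_fg.1 he) (Module.Finite.iff_fg.1 hf)

/-- The larger lattice is `diagLattice` with zero exponents, so the same coefficient maps count both
codimensions. The `e`-part has real dimension `2 (∑ d j + n - dim W) - 2 (n - dim W₀)`; `hm` states
this without truncated subtraction. -/
theorem hasDimVector_residueLattice_quotient {n : ℕ} (d : Fin n → ℕ)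
    (W W₀ : Submodule ℂ (Fin n → ℂ)) {F : Submodule A (Mat n)} (hF : F = residueLattice W₀)
    (h : diagLattice d W ≤ F) {m s : ℕ}
    (hm : m + Module.finrank ℂ W = s + Module.finrank ℂ W₀) (hs : s = ∑ j, d j) :
    HasDimVector (F ⧸ (diagLattice d W).submoduleOf F) (m, s) := by
  subst hF
  have he := finrank_range_lsmul_quotient e e_mul_e (diagLattice d W) (residueLattice W₀) h
    (upperCoeffs d W) (upperCoeffs_surjective d W) (upperCoeffs_eq_zero_iff d W)
    (upperCoeffs (fun _ => 0) W₀) (upperCoeffs_surjective _ W₀)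
    (fun x => by rw [upperCoeffs_eq_zero_iff, diagLattice_zero])
  have hf := finrank_range_lsmul_quotient f f_mul_f (diagLattice d W) (residueLattice W₀) h
    (lastRowCoeffs d) (lastRowCoeffs_surjective d) (lastRowCoeffs_eq_zero_iff d W)
    (lastRowCoeffs fun _ => 0) (lastRowCoeffs_surjective _)
    (fun x => by rw [lastRowCoeffs_eq_zero_iff _ W₀, diagLattice_zero])
  refine ⟨finite_of_range_lsmul he.1 hf.1, ?_, ?_⟩
  · have h1 := finrank_upperCoeffs_codomain d W
    have h2 := finrank_upperCoeffs_codomain (fun _ => 0) W₀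
    have h3 := he.2
    simp only [Finset.sum_const_zero] at h2
    dsimp only
    omega
  · have h3 := hf.2
    simp only [Module.finrank_pi_fintype, Module.finrank_self, Finset.sum_const, Finset.card_univ,
      Fintype.card_fin, smul_eq_mul, mul_one, mul_zero, add_zero] at h3
    rw [hs]
    exact h3

/-! ### Tops -/

section Top

variable {X Y : Type*} [AddCommGroup X] [Module A X] [AddCommGroup Y] [Module A Y]

theorem jacobson_eq_of_greatest {K : Submodule A X} (hK : K ≠ ⊤)
    (h : ∀ N : Submodule A X, N ≠ ⊤ → N ≤ K) : Module.jacobson A X = K ∧ IsCoatom K := by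
  have hco : IsCoatom K := ⟨hK, fun N hN => by
    by_contra hne
    exact absurd (h N hne) (not_le_of_gt hN)⟩
  refine ⟨le_antisymm (sInf_le hco) (le_sInf fun N hN => ?_), hco⟩
  exact ((hN.le_iff.1 (h N hN.1)).resolve_left hK).le

/-- If every proper submodule of `X` lies in the kernel of a surjection `g : X → Y`, then `Y` is
the top of `X`, and it is simple. -/
theorem top_of_surjective [Nontrivial Y] (g : X →ₗ[A] Y) (hg : Function.Surjective g)
    (h : ∀ N : Submodule A X, N ≠ ⊤ → N ≤ LinearMap.ker g) :
    IsSimpleModule A (TopOf X) ∧ Nonempty (TopOf X ≃ₗ[A] Y) := by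
  have hK : LinearMap.ker g ≠ ⊤ := by
    intro hk
    obtain ⟨y, hy⟩ := exists_ne (0 : Y)
    obtain ⟨x, rfl⟩ := hg y
    exact hy (LinearMap.mem_ker.1 (hk ▸ Submodule.mem_top))
  obtain ⟨h1, h2⟩ := jacobson_eq_of_greatest hK h
  refine ⟨?_, ⟨(Submodule.quotEquivOfEq _ _ h1).trans (g.quotKerEquivOfSurjective hg)⟩⟩
  rw [isSimpleModule_iff_isCoatom, h1]
  exact h2

/-- The same statement for a nonzero quotient of `X`. -/
theorem top_quotient_of_surjective [Nontrivial Y] (g : X →ₗ[A] Y) (hg : Function.Surjective g)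
    (h : ∀ N : Submodule A X, N ≠ ⊤ → N ≤ LinearMap.ker g) {N : Submodule A X} (hN : N ≠ ⊤) :
    IsSimpleModule A (TopOf (X ⧸ N)) ∧ Nonempty (TopOf (X ⧸ N) ≃ₗ[A] Y) := by
  refine top_of_surjective (N.liftQ g (h N hN)) ?_ ?_
  · intro y
    obtain ⟨x, rfl⟩ := hg y
    exact ⟨N.mkQ x, rfl⟩
  · intro K hK
    have hc : K.comap N.mkQ ≠ ⊤ := by
      intro hc
      apply hK
      rw [← Submodule.map_comap_eq_of_surjective N.mkQ_surjective K, hc, Submodule.map_top,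
        Submodule.range_mkQ]
    intro z hz
    obtain ⟨x, rfl⟩ := N.mkQ_surjective z
    exact h _ hc (show x ∈ K.comap N.mkQ from hz)

theorem nonempty_top_equiv_of_equiv (φ : X ≃ₗ[A] Y) : Nonempty (TopOf X ≃ₗ[A] TopOf Y) :=
  ⟨Submodule.Quotient.equiv _ _ φ (Module.map_jacobson_of_bijective φ.bijective)⟩

end Top

/-! ### The projective lattices -/

/-- The element of `A` with a given matrix. -/
def ofMatrix (m : Matrix (Fin 3) (Fin 3) R) (h : m ∈ gelfandOrder) : A := ⟨m, h⟩

theorem mat_ofMatrix (m : Matrix (Fin 3) (Fin 3) R) (h : m ∈ gelfandOrder) :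
    mat (ofMatrix m h) = m := rfl

/-- A `3 × 2` matrix, completed by a zero column on the right. -/
def padRight (x : Mat 2) : Matrix (Fin 3) (Fin 3) R := fun i => ![x i 0, x i 1, 0]

/-- A column, completed by two zero columns on the left. -/
def padLeft (x : Mat 1) : Matrix (Fin 3) (Fin 3) R := fun i => ![0, 0, x i 0]

theorem padRight_add (x y : Mat 2) : padRight (x + y) = padRight x + padRight y := by
  ext i j : 1
  fin_cases j <;> simp [padRight, add_entry]

theorem padLeft_add (x y : Mat 1) : padLeft (x + y) = padLeft x + padLeft y := by
  ext i j : 1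
  fin_cases j <;> simp [padLeft, add_entry]

theorem padRight_smul (a : A) (x : Mat 2) : padRight (a • x) = mat a * padRight x := by
  ext i j : 1
  rw [Matrix.mul_apply, Fin.sum_univ_three]
  fin_cases j <;> simp [padRight, smul_entry]

theorem padLeft_smul (a : A) (x : Mat 1) : padLeft (a • x) = mat a * padLeft x := by
  ext i j : 1
  rw [Matrix.mul_apply, Fin.sum_univ_three]
  fin_cases j <;> simp [padLeft, smul_entry]

theorem padRight_mem {x : Mat 2} (hx : x ∈ P) : padRight x ∈ gelfandOrder :=
  ⟨by simp [padRight, ev], by simp [padRight, ev], hx.1, hx.2⟩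

theorem padLeft_mem {x : Mat 1} (hx : x ∈ Q) : padLeft x ∈ gelfandOrder :=
  ⟨hx.1, hx.2, by simp [padLeft, ev], by simp [padLeft, ev]⟩

/-- The embedding of `P = A e` into `A`. -/
def embP : P →ₗ[A] A where
  toFun x := ofMatrix (padRight x) (padRight_mem x.2)
  map_add' x y := Subtype.ext (padRight_add x y)
  map_smul' a x := Subtype.ext (padRight_smul a x)

/-- The embedding of `Q = A f` into `A`. -/
def embQ : Q →ₗ[A] A where
  toFun x := ofMatrix (padLeft x) (padLeft_mem x.2)
  map_add' x y := Subtype.ext (padLeft_add x y)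
  map_smul' a x := Subtype.ext (padLeft_smul a x)

/-- The generator of `P`. -/
def genP : P := ⟨fun i j => if i = 0 ∧ j = 0 ∨ i = 1 ∧ j = 1 then 1 else 0, by
  constructor <;> simp [ev]⟩

/-- The generator of `Q`. -/
def genQ : Q := ⟨lastRow fun _ => 1, by constructor <;> simp [ev, lastRow]⟩

theorem genP_entry (i : Fin 3) (j : Fin 2) :
    genP.1 i j = if i = 0 ∧ j = 0 ∨ i = 1 ∧ j = 1 then 1 else 0 := rfl

theorem embP_genP : embP genP = e := by
  apply A.ext
  intro i j
  change padRight genP.1 i j = (!![1, 0, 0; 0, 1, 0; 0, 0, 0] : Matrix (Fin 3) (Fin 3) R) i j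
  fin_cases i <;> fin_cases j <;> simp [padRight, genP_entry]

theorem embQ_genQ : embQ genQ = f := by
  apply A.ext
  intro i j
  change padLeft (lastRow fun _ => 1) i j =
    (!![0, 0, 0; 0, 0, 0; 0, 0, 1] : Matrix (Fin 3) (Fin 3) R) i j
  fin_cases i <;> fin_cases j <;> simp [padLeft, lastRow]

theorem embP_smul_entry {n : ℕ} (x : P) (y : Mat n) (i : Fin 3) (j : Fin n) :
    (embP x • y) i j = x.1 i 0 * y 0 j + x.1 i 1 * y 1 j := by
  rw [smul_entry]
  change padRight x.1 i 0 * _ + padRight x.1 i 1 * _ + padRight x.1 i 2 * _ = _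
  simp [padRight]

theorem embP_smul_genP (x : P) : embP x • genP = x := by
  apply Subtype.ext
  apply Mat.ext
  intro i j
  change (embP x • genP.1) i j = _
  rw [embP_smul_entry]
  fin_cases j <;> simp [genP_entry]

theorem embQ_smul_genQ (x : Q) : embQ x • genQ = x := by
  apply Subtype.ext
  apply Mat.ext
  intro i j
  change (embQ x • (lastRow fun _ => 1)) i j = _
  rw [smul_entry]
  change padLeft x.1 i 0 * _ + padLeft x.1 i 1 * _ + padLeft x.1 i 2 * _ = _
  fin_cases j
  simp [padLeft, lastRow]

theorem S_smul_def (a : A) (z : S) : a • z = (toC a * (show ℂ from z) : ℂ) := rfl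

theorem T_smul_def (a : A) (z : T) : a • z = (toR a * (show ℝ from z) : ℝ) := rfl

instance : Nontrivial S := inferInstanceAs (Nontrivial ℂ)
instance : Nontrivial T := inferInstanceAs (Nontrivial ℝ)

/-- The projection of `P` onto its top. -/
def topP : P →ₗ[A] S where
  toFun x := (residue x.1 0 : ℂ)
  map_add' x y := congrFun (residue_add x.1 y.1) 0
  map_smul' a x := congrFun (residue_smul a x.1) 0

/-- The projection of `Q` onto its top. -/
def topQ : Q →ₗ[A] T where
  toFun x := (ev (x.1 2 0) : ℝ)
  map_add' x y := map_add constantCoeff (x.1 2 0) (y.1 2 0)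
  map_smul' a x := by
    obtain ⟨h1, h2⟩ := x.2
    change ev ((a • x.1) 2 0) = ev (mat a 2 2) * ev (x.1 2 0)
    simp only [ev] at *
    simp [smul_entry, h1, h2]

theorem topP_surjective : Function.Surjective topP := by
  intro (z : ℂ)
  refine ⟨ofComplex z • genP, (map_smul topP _ _).trans ?_⟩
  change toC (ofComplex z) * residue genP.1 0 = z
  have : residue genP.1 0 = 1 := by apply Complex.ext <;> simp [residue, genP_entry]
  rw [toC_ofComplex, this, mul_one]

theorem topQ_surjective : Function.Surjective topQ := by
  intro (z : ℝ)
  refine ⟨scalar (C z) • genQ, ?_⟩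
  change ev ((scalar (C z) • lastRow fun _ => 1) 2 0) = z
  rw [scalar_smul_entry, lastRow_entry]
  simp [ev]

/-- The upper block of an element outside the kernel has determinant `α² + β² ≠ 0` modulo `𝔪`. Its
inverse, bordered by zeros, lies in `A` and carries the element to the generator of `P`. -/
theorem le_ker_topP (N : Submodule A P) (hN : N ≠ ⊤) :
    N ≤ LinearMap.ker topP := by
  intro x hx
  by_contra h
  apply hN
  replace h : residue x.1 0 ≠ 0 := h
  obtain ⟨h1, h2⟩ := x.2
  simp only [ev] at h1 h2
  set δ : R := x.1 0 0 * x.1 1 1 - x.1 0 1 * x.1 1 0 with hδ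
  have hδ0 : constantCoeff δ ≠ 0 := by
    intro h0
    apply h
    rw [hδ, map_sub, map_mul, map_mul, ← h1, h2] at h0
    have h3 : constantCoeff (x.1 0 1) = 0 := by nlinarith
    have h4 : constantCoeff (x.1 0 0) = 0 := by nlinarith
    apply Complex.ext <;> simp [residue, h2, h3, h4]
  have hinv : δ * δ⁻¹ = 1 := PowerSeries.mul_inv_cancel δ hδ0
  obtain ⟨a, hm⟩ : ∃ a : A, mat a = !![x.1 1 1 * δ⁻¹, - x.1 0 1 * δ⁻¹, 0;
      - x.1 1 0 * δ⁻¹, x.1 0 0 * δ⁻¹, 0; 0, 0, 0] :=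
    ⟨ofMatrix _ (by refine ⟨?_, ?_, ?_, ?_⟩ <;> simp [ev, h1, h2]), mat_ofMatrix _ _⟩
  have ha : a • x = genP := by
    apply Subtype.ext
    apply Mat.ext
    intro i j
    change (a • x.1) i j = _
    rw [smul_entry, genP_entry, hm]
    fin_cases i <;> fin_cases j <;> simp
    · linear_combination hinv
    · ring
    · ring
    · linear_combination hinv
  rw [eq_top_iff]
  intro y _
  rw [← embP_smul_genP y, ← ha]
  exact N.smul_mem _ (N.smul_mem _ hx)

theorem le_ker_topQ (N : Submodule A Q) (hN : N ≠ ⊤) :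
    N ≤ LinearMap.ker topQ := by
  intro x hx
  by_contra h
  apply hN
  replace h : constantCoeff (x.1 2 0) ≠ 0 := h
  have ha : single 2 2 (x.1 2 0)⁻¹ (Or.inl rfl) • x = genQ := by
    apply Subtype.ext
    apply Mat.ext
    intro i j
    change (single 2 2 _ _ • x.1) i j = lastRow (fun _ => 1) i j
    rw [single_smul_entry, lastRow_entry]
    fin_cases j
    simp [PowerSeries.inv_mul_cancel _ h, eq_comm]
  rw [eq_top_iff]
  intro y _
  rw [← embQ_smul_genQ y, ← ha]
  exact N.smul_mem _ (N.smul_mem _ hx)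

/-- The idempotent `f` kills `S` and is the identity on `T`. -/
theorem not_nonempty_S_equiv_T : ¬ Nonempty (S ≃ₗ[A] T) := by
  rintro ⟨φ⟩
  have hS : ∀ z : S, f • z = 0 := by
    intro z
    have : toC f = 0 := by
      apply Complex.ext
      · change ev (0 : R) = 0
        simp [ev]
      · change ev (0 : R) = 0
        simp [ev]
    rw [S_smul_def, this, zero_mul]
    rfl
  have hT : ∀ z : T, f • z = z := by
    intro z
    have : toR f = 1 := by
      change ev (1 : R) = 1
      simp [ev]
    rw [T_smul_def, this, one_mul]
  obtain ⟨z, hz⟩ := exists_ne (0 : T)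
  apply hz
  rw [← φ.symm.map_eq_zero_iff, ← hT z, map_smul, hS]

/-! ### Absolutely cyclic modules as quotients of the projective lattices -/

/-- The minimal polynomial of the action of `t`, read as a power series, annihilates `M`. This is
how finite dimension enters: it makes the lattice of last rows have full rank. -/
theorem exists_scalar_smul_eq_zero (M : Type*) [AddCommGroup M] [Module ℝ M] [Module A M]
    [IsScalarTower ℝ A M] [Module.Finite ℝ M] :
    ∃ r : R, r ≠ 0 ∧ ∀ m : M, scalar r • m = 0 := by
  let τ : Module.End ℝ M := Algebra.lsmul ℝ ℝ M (scalar t)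
  have hp : minpoly ℝ τ ≠ 0 := minpoly.ne_zero (Algebra.IsIntegral.isIntegral τ)
  refine ⟨(minpoly ℝ τ : PowerSeries ℝ), by simpa using hp, fun m => ?_⟩
  let Φ : Polynomial ℝ →ₐ[ℝ] Module.End ℝ M :=
    ((Algebra.lsmul ℝ ℝ M).comp scalar).comp (Polynomial.coeToPowerSeries.algHom ℝ)
  have hΦ : Φ = Polynomial.aeval τ := by
    apply Polynomial.algHom_ext
    simp [Φ, τ]
  have h0 : Φ (minpoly ℝ τ) = 0 := by rw [hΦ, minpoly.aeval]
  have h1 := congrArg (fun g : Module.End ℝ M => g m) h0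
  simpa [Φ] using h1

theorem exists_quotient_equiv_of_generator {X M : Type*} [AddCommGroup X] [Module A X]
    [AddCommGroup M] [Module A M] [Nontrivial M] (emb : X →ₗ[A] A) (g : X) (m : M)
    (hm : emb g • m = m) (hspan : ∀ y : M, ∃ a : A, a • m = y) :
    ∃ N : Submodule A X, N ≠ ⊤ ∧ Nonempty (M ≃ₗ[A] X ⧸ N) := by
  let φ : X →ₗ[A] M := (LinearMap.toSpanSingleton A M m).comp emb
  have hφ : Function.Surjective φ := by
    intro y
    obtain ⟨a, rfl⟩ := hspan y
    exact ⟨a • g, by simp [φ, hm]⟩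
  refine ⟨LinearMap.ker φ, ?_, ⟨(φ.quotKerEquivOfSurjective hφ).symm⟩⟩
  intro h
  obtain ⟨y, hy⟩ := exists_ne (0 : M)
  obtain ⟨x, rfl⟩ := hφ y
  exact hy (LinearMap.mem_ker.1 (h ▸ Submodule.mem_top))

/-- As `M` is finitely generated, each proper submodule lies in a maximal one, and a simple top
leaves only the radical. For `x` outside the radical, one of `e x`, `f x` is outside too and
generates `M`; being fixed by its idempotent, it is the image of the generator of `A e` or `A f`. -/
theorem IsAbsolutelyCyclic.exists_quotient {M : Type*} [AddCommGroup M] [Module ℝ M] [Module A M]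
    [IsScalarTower ℝ A M] (h : IsAbsolutelyCyclic M) :
    (∃ N : Submodule A P, N ≠ ⊤ ∧ Nonempty (M ≃ₗ[A] P ⧸ N)) ∨
    (∃ N : Submodule A Q, N ≠ ⊤ ∧ Nonempty (M ≃ₗ[A] Q ⧸ N)) := by
  have := h.finite
  have : Module.Finite A M := Module.Finite.of_restrictScalars_finite ℝ A M
  have hco : IsCoatom (Module.jacobson A M) := isSimpleModule_iff_isCoatom.1 h.simple_top
  have hle : ∀ N : Submodule A M, N ≠ ⊤ → N ≤ Module.jacobson A M := by
    intro N hN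
    obtain ⟨K, hK, hNK⟩ := (eq_top_or_exists_le_coatom N).resolve_left hN
    have := (hco.le_iff.1 (sInf_le hK : Module.jacobson A M ≤ K)).resolve_left hK.1
    exact this ▸ hNK
  have hgen : ∀ m : M, m ∉ Module.jacobson A M → ∀ y : M, ∃ a : A, a • m = y := by
    intro m hm y
    have : Submodule.span A {m} = ⊤ := by
      by_contra hne
      exact hm (hle _ hne (Submodule.mem_span_singleton_self m))
    exact Submodule.mem_span_singleton.1 (this ▸ Submodule.mem_top)
  obtain ⟨x, hx⟩ : ∃ x, x ∉ Module.jacobson A M := by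
    by_contra! hall
    exact hco.1 (eq_top_iff.2 fun x _ => hall x)
  have : Nontrivial M := ⟨x, 0, fun h0 => hx (h0 ▸ Submodule.zero_mem _)⟩
  by_cases hex : e • x ∈ Module.jacobson A M
  · right
    have hfx : f • x ∉ Module.jacobson A M := by
      intro hfx
      apply hx
      have := Submodule.add_mem _ hex hfx
      rwa [← add_smul, e_add_f, one_smul] at this
    exact exists_quotient_equiv_of_generator embQ genQ (f • x)
      (by rw [embQ_genQ, ← mul_smul, f_mul_f]) (hgen _ hfx)
  · left
    exact exists_quotient_equiv_of_generator embP genP (e • x)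
      (by rw [embP_genP, ← mul_smul, e_mul_e]) (hgen _ hex)

theorem top_quotient_P {N : Submodule A P} (hN : N ≠ ⊤) :
    IsSimpleModule A (TopOf (P ⧸ N)) ∧ Nonempty (TopOf (P ⧸ N) ≃ₗ[A] S) :=
  top_quotient_of_surjective topP topP_surjective le_ker_topP hN

theorem top_quotient_Q {N : Submodule A Q} (hN : N ≠ ⊤) :
    IsSimpleModule A (TopOf (Q ⧸ N)) ∧ Nonempty (TopOf (Q ⧸ N) ≃ₗ[A] T) :=
  top_quotient_of_surjective topQ topQ_surjective le_ker_topQ hN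

theorem IsAbsolutelyCyclic.exists_quotient_of_top_T {M : Type*} [AddCommGroup M] [Module ℝ M]
    [Module A M] [IsScalarTower ℝ A M] (h : IsAbsolutelyCyclic M)
    (hT : Nonempty (TopOf M ≃ₗ[A] T)) :
    ∃ N : Submodule A Q, N ≠ ⊤ ∧ Nonempty (M ≃ₗ[A] Q ⧸ N) := by
  refine h.exists_quotient.resolve_left ?_
  rintro ⟨N, hN, ⟨φ⟩⟩
  obtain ⟨α⟩ := hT
  obtain ⟨β⟩ := nonempty_top_equiv_of_equiv φ
  obtain ⟨γ⟩ := (top_quotient_P hN).2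
  exact not_nonempty_S_equiv_T ⟨γ.symm.trans (β.symm.trans α)⟩

theorem IsAbsolutelyCyclic.exists_quotient_of_top_S {M : Type*} [AddCommGroup M] [Module ℝ M]
    [Module A M] [IsScalarTower ℝ A M] (h : IsAbsolutelyCyclic M)
    (hS : Nonempty (TopOf M ≃ₗ[A] S)) :
    ∃ N : Submodule A P, N ≠ ⊤ ∧ Nonempty (M ≃ₗ[A] P ⧸ N) := by
  refine h.exists_quotient.resolve_right ?_
  rintro ⟨N, hN, ⟨φ⟩⟩
  obtain ⟨α⟩ := hS
  obtain ⟨β⟩ := nonempty_top_equiv_of_equiv φ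
  obtain ⟨γ⟩ := (top_quotient_Q hN).2
  exact not_nonempty_S_equiv_T ⟨α.symm.trans (β.trans γ)⟩

theorem IsAbsolutelyCyclic.top {M : Type*} [AddCommGroup M] [Module ℝ M] [Module A M]
    [IsScalarTower ℝ A M] (h : IsAbsolutelyCyclic M) :
    Nonempty (TopOf M ≃ₗ[A] T) ∨ Nonempty (TopOf M ≃ₗ[A] S) := by
  rcases h.exists_quotient with ⟨N, hN, ⟨φ⟩⟩ | ⟨N, hN, ⟨φ⟩⟩
  · obtain ⟨β⟩ := nonempty_top_equiv_of_equiv φ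
    obtain ⟨γ⟩ := (top_quotient_P hN).2
    exact Or.inr ⟨β.trans γ⟩
  · obtain ⟨β⟩ := nonempty_top_equiv_of_equiv φ
    obtain ⟨γ⟩ := (top_quotient_Q hN).2
    exact Or.inl ⟨β.trans γ⟩

/-! ### The standard lattices and the images of the maps between them -/

theorem Q_eq_residueLattice : Q = residueLattice ⊥ := by
  ext x
  rw [mem_residueLattice, Submodule.mem_bot]
  constructor
  · rintro ⟨h1, h2⟩
    funext j
    fin_cases j
    exact Complex.ext h1 h2
  · intro h
    exact ⟨congrArg Complex.re (congrFun h 0), congrArg Complex.im (congrFun h 0)⟩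

theorem L_eq_residueLattice : L = residueLattice ⊤ := by
  ext x
  simp [L, mem_residueLattice]

/-- The shape `(α, -β; β, α)` says that the second column, as a complex number, is `i` times the
first. -/
theorem P_eq_residueLattice : P = residueLattice (Submodule.span ℂ {![1, Complex.I]}) := by
  ext x
  rw [mem_residueLattice, Submodule.mem_span_singleton]
  constructor
  · rintro ⟨h1, h2⟩
    refine ⟨residue x 0, ?_⟩
    simp only [ev] at h1 h2
    funext j
    fin_cases j
    · simp
    · apply Complex.ext <;> simp [residue, h1, h2]
  · rintro ⟨z, hz⟩
    have h0 : z = residue x 0 := by simpa using congrFun hz 0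
    have h1 : z * Complex.I = residue x 1 := by simpa using congrFun hz 1
    rw [h0] at h1
    have h2 := congrArg Complex.re h1
    have h3 := congrArg Complex.im h1
    simp [residue] at h2 h3
    exact ⟨h3, by simp only [ev]; linarith⟩

theorem mem_dsum {F G : Submodule A (Mat 1)} {x : Mat 2} :
    x ∈ dsum F G ↔ col 0 x ∈ F ∧ col 1 x ∈ G := Iff.rfl

theorem residue_col {n : ℕ} (j : Fin n) (x : Mat n) (i : Fin 1) :
    residue (col j x) i = residue x j := rfl

theorem dsum_Q_Q_eq_residueLattice : dsum Q Q = residueLattice ⊥ := by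
  ext x
  rw [mem_dsum, Q_eq_residueLattice]
  simp [mem_residueLattice, funext_iff, residue_col, Fin.forall_fin_two]

theorem dsum_L_L_eq_residueLattice : dsum L L = residueLattice ⊤ := by
  ext x
  rw [mem_dsum, L_eq_residueLattice]
  simp [mem_residueLattice]

theorem dsum_L_Q_eq_residueLattice :
    dsum L Q = residueLattice (Submodule.span ℂ {![1, 0]}) := by
  ext x
  rw [mem_dsum, Q_eq_residueLattice, L_eq_residueLattice]
  simp [mem_residueLattice, funext_iff, residue_col, Fin.forall_fin_two,
    Submodule.mem_span_singleton, eq_comm]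

theorem range_latticeMap {n m : ℕ} (F : Submodule A (Mat n)) (F' : Submodule A (Mat m))
    (Z : Matrix (Fin n) (Fin m) R) (h : ∀ x ∈ F, rmul Z x ∈ F') :
    LinearMap.range (latticeMap F F' Z h) = (F.map (rmul Z)).submoduleOf F' := by
  ext y
  constructor
  · rintro ⟨x, rfl⟩
    exact ⟨x, x.2, rfl⟩
  · rintro ⟨x, hx, hy⟩
    exact ⟨⟨x, hx⟩, Subtype.ext hy⟩

theorem submoduleOf_map_subtype {n : ℕ} {F : Submodule A (Mat n)} (N : Submodule A F) :
    (N.map F.subtype).submoduleOf F = N :=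
  Submodule.comap_map_eq_of_injective F.injective_subtype N

/-! ### Lattices of last rows and invariance of dimension vectors -/

theorem lastRow_add_mem {n : ℕ} {N : Submodule A (Mat n)} {v w : Fin n → R}
    (hv : lastRow v ∈ N) (hw : lastRow w ∈ N) : lastRow (v + w) ∈ N := by
  convert N.add_mem hv hw using 1
  apply Mat.ext
  intro i j
  rw [add_entry]
  simp only [lastRow_entry]
  split_ifs <;> simp

theorem lastRow_smul_mem {n : ℕ} {N : Submodule A (Mat n)} {v : Fin n → R} (r : R)
    (hv : lastRow v ∈ N) : lastRow (r • v) ∈ N := by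
  convert N.smul_mem (scalar r) hv using 1
  apply Mat.ext
  intro i j
  rw [scalar_smul_entry]
  simp only [lastRow_entry]
  split_ifs <;> simp

/-- The lattice of last rows of a submodule. -/
def rows {n : ℕ} (N : Submodule A (Mat n)) : Submodule R (Fin n → R) where
  carrier := {v | lastRow v ∈ N}
  zero_mem' := by
    change lastRow 0 ∈ N
    convert N.zero_mem using 1
    apply Mat.ext
    intro i j
    simp [lastRow_entry, zero_entry]
  add_mem' := lastRow_add_mem
  smul_mem' r _ := lastRow_smul_mem r

theorem mem_rows {n : ℕ} {N : Submodule A (Mat n)} {v : Fin n → R} :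
    v ∈ rows N ↔ lastRow v ∈ N := Iff.rfl

theorem exists_mem_iff_t_pow_dvd {I : Ideal R} (hI : I ≠ ⊥) : ∃ k, ∀ r, r ∈ I ↔ t ^ k ∣ r := by
  obtain ⟨k, hk⟩ := IsDiscreteValuationRing.ideal_eq_span_pow_irreducible hI
    (PowerSeries.X_prime.irreducible : Irreducible (PowerSeries.X : PowerSeries ℝ))
  exact ⟨k, fun r => by rw [hk, Ideal.mem_span_singleton]⟩

theorem HasDimVector.ne_top {X : Type*} [AddCommGroup X] [Module ℝ X] [Module A X]
    [IsScalarTower ℝ A X] {N : Submodule A X} {d : ℕ × ℕ} (h : HasDimVector (X ⧸ N) d)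
    (hd : d.1 ≠ 0 ∨ d.2 ≠ 0) : N ≠ ⊤ := by
  rintro rfl
  have h1 := h.dim_e
  have h2 := h.dim_f
  rw [Module.finrank_zero_of_subsingleton] at h1 h2
  omega

theorem HasDimVector.unique {M : Type*} [AddCommGroup M] [Module ℝ M] [Module A M]
    [IsScalarTower ℝ A M] {d d' : ℕ × ℕ} (h : HasDimVector M d) (h' : HasDimVector M d') :
    d = d' := by
  have h1 := h.dim_e
  have h2 := h.dim_f
  rw [h'.dim_e] at h1
  rw [h'.dim_f] at h2
  exact Prod.ext (by omega) h2.symm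

/-! ### Modules with top `T` -/

/-- The exponent of a normal form with top `T`. -/
def FormT.exponent : FormT → ℕ
  | .QQ k _ => k
  | .LQ k _ => k

/-- The complex subspace of a normal form with top `T`. -/
def FormT.subspace : FormT → Submodule ℂ (Fin 1 → ℂ)
  | .QQ _ _ => ⊥
  | .LQ _ _ => ⊤

theorem FormT.image_eq (p : FormT) :
    p.image = (diagLattice (fun _ => p.exponent) p.subspace).submoduleOf Q := by
  have hdiag : ∀ k : ℕ, (!![t ^ k] : Matrix (Fin 1) (Fin 1) R) = diag fun _ => k := by
    intro k
    ext i j : 1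
    fin_cases i; fin_cases j
    simp [diag]
  cases p with
  | QQ k hk =>
    refine (range_latticeMap _ _ _ _).trans ?_
    rw [hdiag, diagLattice]
    congr 2
    exact Q_eq_residueLattice
  | LQ k hk =>
    refine (range_latticeMap _ _ _ _).trans ?_
    rw [hdiag, diagLattice]
    congr 2

theorem FormT.diagLattice_le (p : FormT) :
    diagLattice (fun _ => p.exponent) p.subspace ≤ Q := by
  rintro _ ⟨w, hw, rfl⟩
  cases p with
  | QQ k hk =>
    have hw0 : residue w = 0 := hw
    have h1 : constantCoeff (w 0 0) = 0 := congrArg Complex.re (congrFun hw0 0)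
    have h2 : constantCoeff (w 1 0) = 0 := congrArg Complex.im (congrFun hw0 0)
    constructor <;> simp [rmul_diag_entry, h1, h2]
  | LQ k hk =>
    have : k ≠ 0 := by omega
    constructor <;> simp [rmul_diag_entry, FormT.exponent, this]

theorem FormT.hasDimVector (p : FormT) : HasDimVector p.Mod p.dimVector := by
  have h := fun m s => hasDimVector_residueLattice_quotient (m := m) (s := s) _ _ _ Q_eq_residueLattice
    p.diagLattice_le
  rw [← p.image_eq] at h
  have hb : Module.finrank ℂ (⊥ : Submodule ℂ (Fin 1 → ℂ)) = 0 := finrank_bot ℂ _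
  have ht : Module.finrank ℂ (⊤ : Submodule ℂ (Fin 1 → ℂ)) = 1 := by
    rw [finrank_top, Module.finrank_fin_fun]
  rw [hb] at h
  cases p with
  | QQ k hk =>
    exact h k k (congrArg (k + ·) hb) (by simp [FormT.exponent])
  | LQ k hk =>
    refine h (k - 1) k ((congrArg (k - 1 + ·) ht).trans ?_) (by simp [FormT.exponent])
    omega

theorem FormT.image_ne_top (p : FormT) : p.image ≠ ⊤ := by
  refine p.hasDimVector.ne_top ?_
  cases p <;> simp [FormT.dimVector] <;> omega

/-- With `k ≥ 1` the vectors `(k, k)` and `(k - 1, k)` never coincide, so for top `T` the dimension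
vector alone gives uniqueness. -/
theorem FormT.dimVector_injective : Function.Injective FormT.dimVector := by
  intro p q h
  cases p <;> cases q <;> simp [FormT.dimVector] at h ⊢ <;> omega

/-- The last entries form a nonzero ideal `(t ^ k)`, and a subspace of `ℂ¹` is `0` or everything.
The exponent `k = 0` is impossible: it gives `Q` itself in the first case, and `L`, which is not
contained in `Q`, in the second. -/
theorem exists_formT {N : Submodule A Q} (hN : N ≠ ⊤) [Module.Finite ℝ (Q ⧸ N)] :
    ∃ p : FormT, p.image = N := by
  obtain ⟨r, hr0, hr⟩ := exists_scalar_smul_eq_zero (Q ⧸ N)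
  set N' := N.map Q.subtype with hN'
  let ι : R →ₗ[R] (Fin 1 → R) := LinearMap.pi fun _ => LinearMap.id
  have hI : (rows N').comap ι ≠ ⊥ := by
    rw [Submodule.ne_bot_iff]
    refine ⟨r, ?_, hr0⟩
    have h1 : scalar r • genQ ∈ N :=
      (Submodule.Quotient.mk_eq_zero N).1 (hr (Submodule.Quotient.mk genQ))
    have h2 : scalar r • genQ.1 ∈ N' := ⟨_, h1, rfl⟩
    have h3 := lastRow_mem_of_mem h2 2
    change lastRow _ ∈ N'
    convert h3 using 2
    funext j
    rw [scalar_smul_entry]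
    simp [ι, genQ, lastRow_entry]
  obtain ⟨k, hk⟩ := exists_mem_iff_t_pow_dvd hI
  obtain ⟨W, hW⟩ := exists_eq_diagLattice N' (fun _ => k) (fun v => by
    have h : v = ι (v 0) := by
      funext j
      fin_cases j
      rfl
    rw [Fin.forall_fin_one, ← hk, Submodule.mem_comap, ← h, mem_rows])
  have hNW : N = (diagLattice (fun _ => k) W).submoduleOf Q := by
    rw [← hW, hN', submoduleOf_map_subtype]
  have hle : diagLattice (fun _ => k) W ≤ Q := by
    rw [← hW]
    exact Submodule.map_subtype_le _ _
  have hWbt : W = ⊥ ∨ W = ⊤ := by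
    by_cases hb : W = ⊥
    · exact Or.inl hb
    · right
      obtain ⟨u, hu, hu0⟩ := (Submodule.ne_bot_iff W).1 hb
      rw [eq_top_iff]
      intro v _
      have hu0' : u 0 ≠ 0 := by
        intro h0
        apply hu0
        funext j
        fin_cases j
        exact h0
      have : v = (v 0 / u 0) • u := by
        funext j
        fin_cases j
        simp [hu0']
      rw [this]
      exact W.smul_mem _ hu
  rcases hWbt with rfl | rfl
  · have hk1 : 1 ≤ k := by
      by_contra h
      obtain rfl : k = 0 := by omega
      apply hN
      rw [hNW, diagLattice_zero, ← Q_eq_residueLattice, Submodule.submoduleOf,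
        Submodule.comap_subtype_self]
    exact ⟨.QQ k hk1, by rw [hNW, FormT.image_eq]; rfl⟩
  · have hk1 : 1 ≤ k := by
      by_contra h
      obtain rfl : k = 0 := by omega
      rw [diagLattice_zero, Q_eq_residueLattice] at hle
      have h1 : lift (fun _ => 1) ∈ residueLattice (⊥ : Submodule ℂ (Fin 1 → ℂ)) :=
        hle (mem_residueLattice.2 Submodule.mem_top)
      rw [mem_residueLattice, residue_lift, Submodule.mem_bot] at h1
      exact one_ne_zero (congrFun h1 0)
    exact ⟨.LQ k hk1, by rw [hNW, FormT.image_eq]; rfl⟩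

theorem isAbsolutelyCyclic_formT (p : FormT) :
    IsAbsolutelyCyclic p.Mod ∧ Nonempty (TopOf p.Mod ≃ₗ[A] T) ∧ HasDimVector p.Mod p.dimVector :=
  ⟨⟨p.hasDimVector.finite, (top_quotient_Q p.image_ne_top).1⟩, (top_quotient_Q p.image_ne_top).2,
    p.hasDimVector⟩

theorem existsUnique_formT {M : Type*} [AddCommGroup M] [Module ℝ M] [Module A M]
    [IsScalarTower ℝ A M] (hM : IsAbsolutelyCyclic M) (hT : Nonempty (TopOf M ≃ₗ[A] T)) :
    ∃! p : FormT, Nonempty (M ≃ₗ[A] p.Mod) := by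
  obtain ⟨N, hN, ⟨φ⟩⟩ := hM.exists_quotient_of_top_T hT
  have := hM.finite
  have : Module.Finite ℝ (Q ⧸ N) := Module.Finite.equiv (φ.restrictScalars ℝ)
  obtain ⟨p, rfl⟩ := exists_formT hN
  refine ⟨p, ⟨φ⟩, ?_⟩
  rintro q ⟨ψ⟩
  exact FormT.dimVector_injective
    (q.hasDimVector.unique (p.hasDimVector.of_equiv (φ.symm.trans ψ)))

/-! ### Automorphisms of `P` -/

/-- The constant part of `Y` has the form `(α, -β; β, α)`; right multiplication by such a matrix is
an endomorphism of `P`. -/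
def IsEndP (Y : Matrix (Fin 2) (Fin 2) R) : Prop :=
  ev (Y 0 0) = ev (Y 1 1) ∧ ev (Y 1 0) = - ev (Y 0 1)

theorem rmul_two_entry (Y : Matrix (Fin 2) (Fin 2) R) (x : Mat 2) (i : Fin 3) (j : Fin 2) :
    rmul Y x i j = x i 0 * Y 0 j + x i 1 * Y 1 j := by
  rw [rmul_entry, Fin.sum_univ_two]

theorem IsEndP.rmul_mem {Y : Matrix (Fin 2) (Fin 2) R} (hY : IsEndP Y) {x : Mat 2} (hx : x ∈ P) :
    rmul Y x ∈ P := by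
  obtain ⟨h1, h2⟩ := hY
  obtain ⟨h3, h4⟩ := hx
  simp only [ev] at *
  constructor <;> simp [rmul_two_entry, h1, h2, h3, h4]; ring

theorem IsEndP.mul {Y Z : Matrix (Fin 2) (Fin 2) R} (hY : IsEndP Y) (hZ : IsEndP Z) :
    IsEndP (Y * Z) := by
  obtain ⟨h1, h2⟩ := hY
  obtain ⟨h3, h4⟩ := hZ
  simp only [ev] at *
  constructor <;> simp [Matrix.mul_apply, Fin.sum_univ_two, h1, h2, h3, h4]; ring

theorem isEndP_one : IsEndP 1 := by
  constructor <;> simp [ev]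

/-- Two submodules are equivalent if an automorphism of `P` maps one to the other. -/
def RightEquiv (N N' : Submodule A (Mat 2)) : Prop :=
  ∃ Y Y' : Matrix (Fin 2) (Fin 2) R, IsEndP Y ∧ IsEndP Y' ∧ Y * Y' = 1 ∧ N.map (rmul Y) = N'

theorem map_rmul_one {n : ℕ} (N : Submodule A (Mat n)) : N.map (rmul 1) = N := by
  have : rmul (1 : Matrix (Fin n) (Fin n) R) = LinearMap.id := LinearMap.ext rmul_one
  rw [this, Submodule.map_id]

theorem RightEquiv.refl (N : Submodule A (Mat 2)) : RightEquiv N N :=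
  ⟨1, 1, isEndP_one, isEndP_one, mul_one 1, map_rmul_one N⟩

theorem RightEquiv.symm {N N' : Submodule A (Mat 2)} (h : RightEquiv N N') : RightEquiv N' N := by
  obtain ⟨Y, Y', hY, hY', h1, rfl⟩ := h
  refine ⟨Y', Y, hY', hY, mul_eq_one_comm.1 h1, ?_⟩
  rw [map_rmul_map_rmul, h1, map_rmul_one]

theorem RightEquiv.trans {N N' N'' : Submodule A (Mat 2)} (h : RightEquiv N N')
    (h' : RightEquiv N' N'') : RightEquiv N N'' := by
  obtain ⟨Y, Y', hY, hY', h1, rfl⟩ := h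
  obtain ⟨Z, Z', hZ, hZ', h2, rfl⟩ := h'
  refine ⟨Y * Z, Z' * Y', hY.mul hZ, hZ'.mul hY', ?_, (map_rmul_map_rmul _ _ _).symm⟩
  rw [mul_assoc, ← mul_assoc Z, h2, one_mul, h1]

theorem RightEquiv.le {N N' : Submodule A (Mat 2)} (h : RightEquiv N N') (hN : N ≤ P) :
    N' ≤ P := by
  obtain ⟨Y, Y', hY, hY', h1, rfl⟩ := h
  rintro _ ⟨x, hx, rfl⟩
  exact hY.rmul_mem (hN hx)

theorem RightEquiv.nonempty_quotient_equiv {N N' : Submodule A (Mat 2)} (h : RightEquiv N N') :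
    Nonempty ((P ⧸ N.submoduleOf P) ≃ₗ[A] (P ⧸ N'.submoduleOf P)) := by
  obtain ⟨Y, Y', hY, hY', h1, rfl⟩ := h
  have h2 : Y' * Y = 1 := mul_eq_one_comm.1 h1
  let φ : P ≃ₗ[A] P := LinearEquiv.ofLinearMap
    (latticeMap P P Y fun _ => hY.rmul_mem) (latticeMap P P Y' fun _ => hY'.rmul_mem)
    (LinearMap.ext fun x => Subtype.ext <| by
      change rmul Y (rmul Y' x.1) = x.1
      rw [rmul_rmul, h2, rmul_one])
    (LinearMap.ext fun x => Subtype.ext <| by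
      change rmul Y' (rmul Y x.1) = x.1
      rw [rmul_rmul, h1, rmul_one])
  refine ⟨Submodule.Quotient.equiv _ _ φ ?_⟩
  ext y
  constructor
  · rintro ⟨x, hx, rfl⟩
    exact ⟨x.1, hx, rfl⟩
  · rintro ⟨x, hx, hy⟩
    have hxP : x ∈ P := by
      have h3 := hY'.rmul_mem y.2
      rwa [show (y : Mat 2) = rmul Y x from hy.symm, rmul_rmul, h1, rmul_one] at h3
    exact ⟨⟨x, hxP⟩, hx, Subtype.ext hy⟩

/-- The rotation-like matrix `(p, -q; q, p)`. -/
def rotation (p q : R) : Matrix (Fin 2) (Fin 2) R := !![p, -q; q, p]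

theorem isEndP_rotation (p q : R) : IsEndP (rotation p q) := by
  constructor <;> simp [ev, rotation]

/-- The determinant `p² + q²` is a unit, since its constant term is a nontrivial sum of real
squares; the inverse is again a rotation. -/
theorem exists_rotation_inverse {p q : R} (h : ev p ≠ 0 ∨ ev q ≠ 0) :
    ∃ Y', IsEndP Y' ∧ rotation p q * Y' = 1 := by
  have h0 : constantCoeff (p * p + q * q) ≠ 0 := by
    simp only [ev] at h
    simp only [map_add, map_mul]
    rcases h with h | h
    · nlinarith [mul_self_pos.2 h, mul_self_nonneg (constantCoeff q)]
    · nlinarith [mul_self_pos.2 h, mul_self_nonneg (constantCoeff p)]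
  have h1 := PowerSeries.mul_inv_cancel _ h0
  refine ⟨rotation (p * (p * p + q * q)⁻¹) (-q * (p * p + q * q)⁻¹), isEndP_rotation _ _, ?_⟩
  ext i j : 1
  rw [Matrix.mul_apply, Fin.sum_univ_two]
  fin_cases i <;> fin_cases j <;> simp [rotation]
  · linear_combination h1
  · ring
  · ring
  · linear_combination h1

theorem RightEquiv.rotation (N : Submodule A (Mat 2)) {p q : R} (h : ev p ≠ 0 ∨ ev q ≠ 0) :
    RightEquiv N (N.map (rmul (rotation p q))) := by
  obtain ⟨Y', hY', h1⟩ := exists_rotation_inverse h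
  exact ⟨_, Y', isEndP_rotation p q, hY', h1, rfl⟩

/-! ### The normal forms with top `S` -/

theorem map_rmul_mul_diag {n : ℕ} (W : Submodule ℂ (Fin n → ℂ)) {Y Y' : Matrix (Fin n) (Fin n) R}
    (h : Y * Y' = 1) (d : Fin n → ℕ) :
    (residueLattice W).map (rmul (Y * diag d)) = diagLattice d (W.map (residueAct Y)) := by
  rw [← map_rmul_map_rmul, map_rmul_residueLattice W h, diagLattice]

/-- What acts on `W` is not `Z` but its conjugate `Y` by `diag d`. A `Z` that is trivial modulo `t`
can therefore act nontrivially on `W`. -/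
theorem diagLattice_map_rmul {n : ℕ} (W : Submodule ℂ (Fin n → ℂ))
    {Y Y' Z : Matrix (Fin n) (Fin n) R} (h : Y * Y' = 1) {d : Fin n → ℕ}
    (hZ : diag d * Z = Y * diag d) :
    (diagLattice d W).map (rmul Z) = diagLattice d (W.map (residueAct Y)) := by
  rw [diagLattice, map_rmul_map_rmul, hZ, map_rmul_mul_diag W h]

/-- The complex line spanned by `(u, v)`. -/
abbrev line (u v : ℂ) : Submodule ℂ (Fin 2 → ℂ) := Submodule.span ℂ {![u, v]}

theorem residueAct_two (Y : Matrix (Fin 2) (Fin 2) R) (u v : ℂ) :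
    residueAct Y ![u, v] = ![u * (ev (Y 0 0) : ℂ) + v * (ev (Y 1 0) : ℂ),
      u * (ev (Y 0 1) : ℂ) + v * (ev (Y 1 1) : ℂ)] := by
  funext j
  rw [residueAct_apply, Fin.sum_univ_two]
  fin_cases j <;> simp

theorem line_map_residueAct (Y : Matrix (Fin 2) (Fin 2) R) (u v : ℂ) :
    (line u v).map (residueAct Y) = line (u * (ev (Y 0 0) : ℂ) + v * (ev (Y 1 0) : ℂ))
      (u * (ev (Y 0 1) : ℂ) + v * (ev (Y 1 1) : ℂ)) := by
  rw [line, Submodule.map_span, Set.image_singleton, residueAct_two]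

theorem mem_line_iff {u v a b : ℂ} (hu : u ≠ 0 ∨ v ≠ 0) : ![a, b] ∈ line u v ↔ a * v = b * u := by
  rw [Submodule.mem_span_singleton]
  constructor
  · rintro ⟨z, hz⟩
    have h0 : z * u = a := by simpa using congrFun hz 0
    have h1 : z * v = b := by simpa using congrFun hz 1
    rw [← h0, ← h1]
    ring
  · intro h
    rcases hu with hu | hu
    · refine ⟨a / u, ?_⟩
      funext j
      fin_cases j
      · simp [hu]
      · simp
        field_simp
        linear_combination h
    · refine ⟨b / v, ?_⟩
      funext j
      fin_cases j
      · simp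
        field_simp
        linear_combination -h
      · simp [hu]

theorem line_smul {z : ℂ} (hz : z ≠ 0) (u v : ℂ) : line (z * u) (z * v) = line u v := by
  have : ![z * u, z * v] = z • ![u, v] := by
    funext j
    fin_cases j <;> simp
  rw [line, this, Submodule.span_singleton_smul_eq (IsUnit.mk0 z hz)]

theorem finrank_line {u v : ℂ} (h : u ≠ 0 ∨ v ≠ 0) : Module.finrank ℂ (line u v) = 1 := by
  apply finrank_span_singleton
  intro h0
  have h1 : u = 0 := by simpa using congrFun h0 0
  have h2 : v = 0 := by simpa using congrFun h0 1
  rcases h with h | h <;> contradiction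

namespace FormS

/-- The exponents of a normal form. -/
def exponents : FormS → Fin 2 → ℕ
  | QQ k l => ![k, k + l]
  | LL k l _ => ![k, k + l]
  | LQ k l _ => ![k, k + l]
  | LQ' k l _ => ![k, k + l]
  | PP k l _ _ _ => ![k, k + l]

/-- The complex subspace of a normal form. -/
def subspace : FormS → Submodule ℂ (Fin 2 → ℂ)
  | QQ _ _ => ⊥
  | LL _ _ _ => ⊤
  | LQ _ _ _ => line 1 0
  | LQ' _ _ _ => line 0 1
  | PP _ _ c _ _ => line 1 (Complex.I * c)

/-- The lattice of a normal form, up to an automorphism of `P`. -/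
def lattice (p : FormS) : Submodule A (Mat 2) := diagLattice p.exponents p.subspace

theorem diag_two (k l : ℕ) : t ^ k • (!![1, 0; 0, t ^ l] : Matrix (Fin 2) (Fin 2) R) =
    diag ![k, k + l] := by
  ext i j : 1
  fin_cases i <;> fin_cases j <;> simp [diag, pow_add]

/-- The image is the standard lattice itself except for `LQ'`, whose exponents are decreasing; hence
the detour through an equivalent `N`. -/
theorem exists_image_eq (p : FormS) :
    ∃ N, p.image = N.submoduleOf P ∧ N ≤ P ∧ RightEquiv N p.lattice := by
  have key : ∀ (F : Submodule A (Mat 2)) (Z : Matrix (Fin 2) (Fin 2) R)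
      (h : ∀ x ∈ F, rmul Z x ∈ P), RightEquiv (F.map (rmul Z)) p.lattice →
      ∃ N, LinearMap.range (latticeMap F P Z h) = N.submoduleOf P ∧ N ≤ P ∧
        RightEquiv N p.lattice := fun F Z h h' =>
    ⟨_, range_latticeMap F P Z h, by rintro _ ⟨x, hx, rfl⟩; exact h x hx, h'⟩
  cases p with
  | QQ k l =>
    refine key _ _ _ ?_
    rw [dsum_Q_Q_eq_residueLattice, diag_two]
    exact .refl _
  | LL k l hk =>
    refine key _ _ _ ?_
    rw [dsum_L_L_eq_residueLattice, diag_two]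
    exact .refl _
  | LQ k l hk =>
    refine key _ _ _ ?_
    rw [dsum_L_Q_eq_residueLattice, diag_two]
    exact .refl _
  | LQ' k l hl =>
    refine key _ _ _ ?_
    -- A quarter turn is an automorphism of `P` that exchanges the columns up to sign, and so sorts
    -- the exponents. The line through `(1, 0)` goes to that through `(0, -1)`.
    have h01 : ev (0 : R) ≠ 0 ∨ ev (1 : R) ≠ 0 := by simp [ev]
    obtain ⟨Y', -, hY'⟩ := exists_rotation_inverse h01
    convert RightEquiv.rotation _ h01 using 1
    rw [dsum_L_Q_eq_residueLattice, map_rmul_map_rmul]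
    have : t ^ k • (!![t ^ l, 0; 0, 1] : Matrix (Fin 2) (Fin 2) R) * rotation 0 1 =
        rotation 0 1 * diag ![k, k + l] := by
      ext i j : 1
      rw [Matrix.mul_apply, Matrix.mul_apply, Fin.sum_univ_two, Fin.sum_univ_two]
      fin_cases i <;> fin_cases j <;> simp [rotation, diag, pow_add]
    rw [this, map_rmul_mul_diag _ hY', line_map_residueAct]
    change diagLattice ![k, k + l] (line 0 1) = _
    congr 1
    rw [← line_smul (z := -1) (by simp)]
    simp [rotation]
  | PP k l c hk hc =>
    refine key _ _ _ ?_
    -- The factor `diag(1, c)` need not be an automorphism of `P`; it is absorbed in the subspace,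
    -- where it moves `(1, i)` to `(1, ic)`.
    have h1 : (!![1, 0; 0, C c] : Matrix (Fin 2) (Fin 2) R) * !![1, 0; 0, C c⁻¹] = 1 := by
      ext i j : 1
      rw [Matrix.mul_apply, Fin.sum_univ_two]
      fin_cases i <;> fin_cases j <;> simp [← map_mul, hc]
    have h2 : t ^ k • (!![1, 0; 0, C c * t ^ l] : Matrix (Fin 2) (Fin 2) R) =
        !![1, 0; 0, C c] * diag ![k, k + l] := by
      ext i j : 1
      rw [Matrix.mul_apply, Fin.sum_univ_two]
      fin_cases i <;> fin_cases j <;> simp [diag, pow_add]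
      ring
    rw [P_eq_residueLattice, h2, map_rmul_mul_diag _ h1, line_map_residueAct]
    convert RightEquiv.refl _ using 1
    simp [lattice, exponents, subspace]

theorem nonempty_equiv_lattice (p : FormS) :
    Nonempty (p.Mod ≃ₗ[A] P ⧸ p.lattice.submoduleOf P) := by
  obtain ⟨N, h1, -, h2⟩ := p.exists_image_eq
  obtain ⟨φ⟩ := h2.nonempty_quotient_equiv
  exact ⟨(Submodule.quotEquivOfEq _ _ h1).trans φ⟩

theorem lattice_le (p : FormS) : p.lattice ≤ P := by
  obtain ⟨N, -, h1, h2⟩ := p.exists_image_eq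
  exact h2.le h1

theorem hasDimVector (p : FormS) : HasDimVector p.Mod p.dimVector := by
  obtain ⟨φ⟩ := p.nonempty_equiv_lattice
  refine HasDimVector.of_equiv ?_ φ.symm
  have h := fun m s => hasDimVector_residueLattice_quotient (m := m) (s := s) _ _ _
    P_eq_residueLattice p.lattice_le
  have hP : Module.finrank ℂ (line 1 Complex.I) = 1 := finrank_line (by simp)
  rw [hP] at h
  cases p with
  | QQ k l =>
    have hW : Module.finrank ℂ (⊥ : Submodule ℂ (Fin 2 → ℂ)) = 0 := finrank_bot ℂ _
    exact h _ _ (congrArg (2 * k + l + 1 + ·) hW) (by simp [exponents]; ring)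
  | LL k l hk =>
    have hW : Module.finrank ℂ (⊤ : Submodule ℂ (Fin 2 → ℂ)) = 2 := by
      rw [finrank_top, Module.finrank_fin_fun]
    refine h (2 * k + l - 1) (2 * k + l) ((congrArg (2 * k + l - 1 + ·) hW).trans ?_)
      (by simp [exponents]; ring)
    omega
  | LQ k l hk =>
    have hW : Module.finrank ℂ (line 1 0) = 1 := finrank_line (by simp)
    exact h _ _ (congrArg (2 * k + l + ·) hW) (by simp [exponents]; ring)
  | LQ' k l hl =>
    have hW : Module.finrank ℂ (line 0 1) = 1 := finrank_line (by simp)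
    exact h _ _ (congrArg (2 * k + l + ·) hW) (by simp [exponents]; ring)
  | PP k l c hk hc =>
    have hW : Module.finrank ℂ (line 1 (Complex.I * c)) = 1 := finrank_line (by simp)
    exact h _ _ (congrArg (2 * k + l + ·) hW) (by simp [exponents]; ring)

theorem image_ne_top (p : FormS) : p.image ≠ ⊤ := by
  refine p.hasDimVector.ne_top ?_
  cases p <;> simp only [dimVector] <;> omega

end FormS

theorem isAbsolutelyCyclic_formS (p : FormS) :
    IsAbsolutelyCyclic p.Mod ∧ Nonempty (TopOf p.Mod ≃ₗ[A] S) ∧ HasDimVector p.Mod p.dimVector :=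
  ⟨⟨p.hasDimVector.finite, (top_quotient_P p.image_ne_top).1⟩, (top_quotient_P p.image_ne_top).2,
    p.hasDimVector⟩

/-! ### Existence of a normal form -/

theorem not_t_pow_succ_dvd (k : ℕ) : ¬ t ^ (k + 1) ∣ t ^ k := by
  intro h
  have := (pow_dvd_pow_iff PowerSeries.X_ne_zero PowerSeries.X_prime.not_isUnit).1 h
  omega

/-- After an automorphism of `P`, the last rows of a lattice form a diagonal lattice. -/
theorem exists_rightEquiv_rows (N : Submodule A (Mat 2)) {r : R} (hr : r ≠ 0)
    (hN : ∀ v : Fin 2 → R, lastRow (r • v) ∈ N) :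
    ∃ N', RightEquiv N N' ∧ ∃ k l : ℕ, ∀ v : Fin 2 → R,
      lastRow v ∈ N' ↔ ∀ j, t ^ (![k, k + l] j) ∣ v j := by
  -- The ideal generated by all entries of rows in the lattice; its exponent `k` is their smallest
  -- valuation, attained by some row `v = t ^ k (p 0, p 1)`.
  let I : Ideal R := ⨆ j : Fin 2, (rows N).map (LinearMap.proj j : (Fin 2 → R) →ₗ[R] R)
  have hmemI : ∀ v ∈ rows N, ∀ j, v j ∈ I := fun v hv j =>
    Submodule.mem_iSup_of_mem j ⟨v, hv, rfl⟩
  have hI : I ≠ ⊥ := by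
    rw [Submodule.ne_bot_iff]
    refine ⟨r, ?_, hr⟩
    simpa using hmemI _ (hN 1) 0
  obtain ⟨k, hk⟩ := exists_mem_iff_t_pow_dvd hI
  obtain ⟨v, hv, j, hj⟩ : ∃ v ∈ rows N, ∃ j, ¬ t ^ (k + 1) ∣ v j := by
    by_contra! hall
    have hle : I ≤ Ideal.span {t ^ (k + 1)} := by
      refine iSup_le fun j => ?_
      rintro _ ⟨v, hv, rfl⟩
      exact Ideal.mem_span_singleton.2 (hall v hv j)
    exact not_t_pow_succ_dvd k (Ideal.mem_span_singleton.1 (hle ((hk _).2 dvd_rfl)))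
  have hvk : ∀ j, ∃ p, v j = t ^ k * p := fun j => (hk _).1 (hmemI v hv j)
  choose p hp using hvk
  have hpj : ev (p j) ≠ 0 := by
    intro h0
    apply hj
    rw [hp j, pow_succ]
    exact mul_dvd_mul_left _ (X_dvd_iff.2 h0)
  have hp01 : ev (p 0) ≠ 0 ∨ ev (p 1) ≠ 0 := by
    fin_cases j
    · exact Or.inl hpj
    · exact Or.inr hpj
  obtain ⟨Y', hY', hYY'⟩ := exists_rotation_inverse hp01
  set Y := rotation (p 0) (p 1) with hY
  set N' := N.map (rmul Y) with hN'
  have hrow : ∀ w, lastRow w ∈ N → Matrix.vecMul w Y ∈ rows N' := by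
    intro w hw
    rw [mem_rows, ← rmul_lastRow]
    exact ⟨_, hw, rfl⟩
  have hdvd : ∀ w ∈ rows N', ∀ j, t ^ k ∣ w j := by
    rintro w ⟨x, hx, hxw⟩ j
    have h1 : w j = x 2 0 * Y 0 j + x 2 1 * Y 1 j := by
      rw [← rmul_two_entry, hxw, lastRow_entry, if_pos rfl]
    have h2 := fun s => (hk _).1 (hmemI _ (lastRow_mem_of_mem hx 2) s)
    rw [h1]
    exact dvd_add (Dvd.dvd.mul_right (h2 0) _) (Dvd.dvd.mul_right (h2 1) _)
  -- The rotation sends `(p 0, p 1)` to `(p 0 ² + p 1 ², 0)`, whose first entry is a unit.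
  have hfirst : ![t ^ k, 0] ∈ rows N' := by
    have hδ : constantCoeff (p 0 * p 0 + p 1 * p 1) ≠ 0 := by
      simp only [ev] at hp01
      simp only [map_add, map_mul]
      rcases hp01 with h | h
      · nlinarith [mul_self_pos.2 h, mul_self_nonneg (constantCoeff (p 1))]
      · nlinarith [mul_self_pos.2 h, mul_self_nonneg (constantCoeff (p 0))]
    have h1 := (rows N').smul_mem (p 0 * p 0 + p 1 * p 1)⁻¹ (hrow v hv)
    convert h1 using 1
    have hinv := PowerSeries.inv_mul_cancel _ hδ
    have hv' : v = ![t ^ k * p 0, t ^ k * p 1] := by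
      funext j
      fin_cases j
      · exact hp 0
      · exact hp 1
    rw [hv', hY]
    funext j
    fin_cases j
    · simp [rotation]
      linear_combination -(t ^ k) * hinv
    · simp [rotation]
      right
      ring
  -- Once the first basis vector is split off, the rows with first entry `0` form an ideal, which
  -- gives the second exponent.
  let ι : R →ₗ[R] (Fin 2 → R) := LinearMap.single R (fun _ => R) 1
  have hι : ∀ a, ι a = ![0, a] := by
    intro a
    funext j
    fin_cases j <;> simp [ι]
  have hJ : (rows N').comap ι ≠ ⊥ := by
    rw [Submodule.ne_bot_iff]
    refine ⟨r, ?_, hr⟩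
    have h1 := hrow _ (hN (Matrix.vecMul ![0, 1] Y'))
    rw [Matrix.smul_vecMul, Matrix.vecMul_vecMul, mul_eq_one_comm.1 hYY', Matrix.vecMul_one] at h1
    rw [Submodule.mem_comap, hι]
    convert h1 using 1
    funext j
    fin_cases j <;> simp
  obtain ⟨m, hm⟩ := exists_mem_iff_t_pow_dvd hJ
  have hkm : k ≤ m := by
    have h1 := hdvd _ ((hm _).2 dvd_rfl) 1
    rw [hι] at h1
    exact (pow_dvd_pow_iff PowerSeries.X_ne_zero PowerSeries.X_prime.not_isUnit).1 h1
  refine ⟨N', ⟨Y, Y', isEndP_rotation _ _, hY', hYY', rfl⟩, k, m - k, fun w => ?_⟩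
  rw [← mem_rows, Fin.forall_fin_two]
  simp only [Matrix.cons_val_zero, Matrix.cons_val_one, Nat.add_sub_cancel' hkm]
  have hsplit : ∀ c, w 0 = t ^ k * c → w = c • ![t ^ k, 0] + ι (w 1) := by
    intro c hc
    funext j
    fin_cases j <;> simp [hι, hc, mul_comm]
  constructor
  · intro hw
    obtain ⟨c, hc⟩ := hdvd w hw 0
    refine ⟨⟨c, hc⟩, (hm _).1 ?_⟩
    rw [Submodule.mem_comap, ← (rows N').add_mem_iff_right ((rows N').smul_mem c hfirst),
      ← hsplit c hc]
    exact hw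
  · rintro ⟨⟨c, hc⟩, h1⟩
    rw [hsplit c hc]
    exact (rows N').add_mem ((rows N').smul_mem c hfirst) ((hm _).2 h1)

/-! ### Complex lines under real rotations and shears -/

theorem subspace_fin_two (W : Submodule ℂ (Fin 2 → ℂ)) :
    W = ⊥ ∨ W = ⊤ ∨ ∃ u v : ℂ, (u ≠ 0 ∨ v ≠ 0) ∧ W = line u v := by
  by_cases hb : W = ⊥
  · exact Or.inl hb
  right
  obtain ⟨w, hw, hw0⟩ := (Submodule.ne_bot_iff W).1 hb
  have hww : w = ![w 0, w 1] := by
    funext j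
    fin_cases j <;> rfl
  have hne : w 0 ≠ 0 ∨ w 1 ≠ 0 := by
    by_contra! h
    apply hw0
    rw [hww, h.1, h.2]
    funext j
    fin_cases j <;> rfl
  have hle : line (w 0) (w 1) ≤ W := by
    rw [Submodule.span_singleton_le_iff_mem, ← hww]
    exact hw
  by_cases h2 : Module.finrank ℂ W = 2
  · left
    exact Submodule.eq_top_of_finrank_eq (by rw [h2, Module.finrank_fin_fun])
  · right
    refine ⟨w 0, w 1, hne, (Submodule.eq_of_le_of_finrank_le hle ?_).symm⟩
    have h3 := Submodule.finrank_le W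
    rw [Module.finrank_fin_fun] at h3
    rw [finrank_line hne]
    omega

/-- A suitable rotation makes two plane vectors orthogonal. -/
theorem exists_rotation_orthogonal (a b p q : ℝ) : ∃ c s : ℝ, (c ≠ 0 ∨ s ≠ 0) ∧
    (a * c + p * s) * (p * c - a * s) + (b * c + q * s) * (q * c - b * s) = 0 := by
  by_cases hB : a * p + b * q = 0
  · exact ⟨1, 0, by simp, by linear_combination hB⟩
  -- The inner product equals `B c² + D c s - B s²`. For `s = 1` its discriminant `D² + 4 B²` is
  -- nonnegative, and `c` is the root with the positive sign.
  · set B := a * p + b * q with hBdef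
    set D := p ^ 2 + q ^ 2 - a ^ 2 - b ^ 2 with hD
    have hs := Real.sq_sqrt (show 0 ≤ D ^ 2 + 4 * B ^ 2 by positivity)
    set σ := Real.sqrt (D ^ 2 + 4 * B ^ 2)
    refine ⟨(σ - D) / (2 * B), 1, by simp, ?_⟩
    have h1 : (σ - D) / (2 * B) * (2 * B) = σ - D := div_mul_cancel₀ _ (by simpa using hB)
    set c := (σ - D) / (2 * B)
    have h2 : B * (B * c ^ 2 + D * c - B) = 0 := by
      have hσ : σ = 2 * B * c + D := by linear_combination -h1
      rw [hσ] at hs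
      linear_combination hs / 4
    have h3 := (mul_eq_zero.1 h2).resolve_left hB
    rw [hBdef, hD] at h3
    linear_combination h3

/-- A plane vector orthogonal to `u` is a real multiple of `i u`, with factor `det(u, v) / |u|²`. By
orthogonality `det(u, v)² = |u|² |v|²`, so the factor is at most `1` in absolute value when `|v| ≤
|u|`. -/
theorem exists_line_eq_of_orthogonal {u v : ℂ} (h : u.re * v.re + u.im * v.im = 0) (hu : u ≠ 0)
    (huv : Complex.normSq v ≤ Complex.normSq u) :
    ∃ μ : ℝ, μ ∈ Set.Icc (-1 : ℝ) 1 ∧ line u v = line 1 (Complex.I * μ) := by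
  have hpos := Complex.normSq_pos.2 hu
  refine ⟨(u.re * v.im - u.im * v.re) / Complex.normSq u, ?_, ?_⟩
  · rw [Set.mem_Icc, ← abs_le, ← sq_le_one_iff_abs_le_one, div_pow, div_le_one (by positivity)]
    have h1 : (u.re * v.im - u.im * v.re) ^ 2 = Complex.normSq u * Complex.normSq v := by
      rw [Complex.normSq_apply, Complex.normSq_apply]
      linear_combination -(u.re * v.re + u.im * v.im) * h
    rw [h1, sq]
    exact mul_le_mul_of_nonneg_left huv hpos.le
  · rw [← line_smul hu 1, mul_one]
    congr 1
    have hne : Complex.normSq u ≠ 0 := hpos.ne'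
    have key : v * Complex.normSq u =
        u * (Complex.I * ((u.re * v.im - u.im * v.re : ℝ) : ℂ)) := by
      rw [Complex.normSq_apply]
      apply Complex.ext
      · simp
        linear_combination u.re * h
      · simp
        linear_combination u.im * h
    have hne' : (Complex.normSq u : ℂ) ≠ 0 := Complex.ofReal_ne_zero.2 hne
    push_cast at key ⊢
    field_simp
    linear_combination key

theorem exists_rotation_line {u v : ℂ} (h : u ≠ 0 ∨ v ≠ 0) :
    ∃ c s : ℝ, (c ≠ 0 ∨ s ≠ 0) ∧ ∃ μ : ℝ, μ ∈ Set.Icc (-1 : ℝ) 1 ∧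
      line (u * c + v * s) (v * c - u * s) = line 1 (Complex.I * μ) := by
  obtain ⟨c, s, hcs, horth⟩ := exists_rotation_orthogonal u.re u.im v.re v.im
  have horth' : (u * c + v * s).re * (v * c - u * s).re +
      (u * c + v * s).im * (v * c - u * s).im = 0 := by
    simp
    linear_combination horth
  have hcs2 : (c : ℂ) ^ 2 + (s : ℂ) ^ 2 ≠ 0 := by
    have : c ^ 2 + s ^ 2 ≠ 0 := by
      rcases hcs with h | h <;> positivity
    exact_mod_cast this
  have hnz : u * c + v * s ≠ 0 ∨ v * c - u * s ≠ 0 := by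
    by_contra! h0
    obtain ⟨h1, h2⟩ := h0
    have hu : u * ((c : ℂ) ^ 2 + (s : ℂ) ^ 2) = 0 := by linear_combination c * h1 - s * h2
    have hv : v * ((c : ℂ) ^ 2 + (s : ℂ) ^ 2) = 0 := by linear_combination s * h1 + c * h2
    have hu0 := (mul_eq_zero.1 hu).resolve_right hcs2
    have hv0 := (mul_eq_zero.1 hv).resolve_right hcs2
    rcases h with h | h <;> contradiction
  rcases le_total (Complex.normSq (v * c - u * s)) (Complex.normSq (u * c + v * s)) with hle | hle
  · have hu : u * c + v * s ≠ 0 := by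
      intro h0
      rw [h0, map_zero] at hle
      have := Complex.normSq_eq_zero.1 (le_antisymm hle (Complex.normSq_nonneg _))
      rcases hnz with h | h <;> contradiction
    exact ⟨c, s, hcs, exists_line_eq_of_orthogonal horth' hu hle⟩
  · have hv : v * c - u * s ≠ 0 := by
      intro h0
      rw [h0, map_zero] at hle
      have := Complex.normSq_eq_zero.1 (le_antisymm hle (Complex.normSq_nonneg _))
      rcases hnz with h | h <;> contradiction
    -- A further quarter turn puts the longer of the two orthogonal vectors first.
    refine ⟨-s, c, by rcases hcs with h | h <;> simp [h], ?_⟩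
    have h1 : u * ((-s : ℝ) : ℂ) + v * c = v * c - u * s := by push_cast; ring
    have h2 : v * ((-s : ℝ) : ℂ) - u * c = -(u * c + v * s) := by push_cast; ring
    rw [h1, h2]
    refine exists_line_eq_of_orthogonal ?_ hv (by rwa [Complex.normSq_neg])
    rw [Complex.neg_re, Complex.neg_im]
    linear_combination -horth'

/-- Rotations act on the subspace of a lattice with equal exponents. -/
theorem rightEquiv_line_rotation (k : ℕ) (u v : ℂ) {c s : ℝ} (h : c ≠ 0 ∨ s ≠ 0) :
    RightEquiv (diagLattice ![k, k + 0] (line u v))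
      (diagLattice ![k, k + 0] (line (u * c + v * s) (v * c - u * s))) := by
  have h' : ev (C c : R) ≠ 0 ∨ ev (C s : R) ≠ 0 := by simpa [ev] using h
  obtain ⟨Y', -, hY'⟩ := exists_rotation_inverse h'
  convert RightEquiv.rotation _ h' using 1
  have hcomm : diag ![k, k + 0] * rotation (C c) (C s) =
      rotation (C c) (C s) * diag ![k, k + 0] := by
    ext i j : 1
    rw [Matrix.mul_apply, Matrix.mul_apply, Fin.sum_univ_two, Fin.sum_univ_two]
    fin_cases i <;> fin_cases j <;> simp [rotation, diag] <;> ring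
  rw [diagLattice_map_rmul _ hY' hcomm, line_map_residueAct]
  congr 2
  simp [rotation, ev]
  ring

/-- A shear by a multiple of `t ^ l` is the identity modulo `t`, hence an automorphism of `P`.
Conjugated by the diagonal matrix it becomes a constant real shear on the line, which can cancel
only the real part of `z`. -/
theorem rightEquiv_line_shear (k : ℕ) {l : ℕ} (hl : 1 ≤ l) (z : ℂ) :
    RightEquiv (diagLattice ![k, k + l] (line 1 z))
      (diagLattice ![k, k + l] (line 1 (Complex.I * z.im))) := by
  have hl0 : l ≠ 0 := by omega
  have hinv : ∀ a : R, (!![1, a; 0, 1] : Matrix (Fin 2) (Fin 2) R) * !![1, -a; 0, 1] = 1 := by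
    intro a
    ext i j : 1
    rw [Matrix.mul_apply, Fin.sum_univ_two]
    fin_cases i <;> fin_cases j <;> simp
  refine ⟨!![1, - C z.re * t ^ l; 0, 1], !![1, -(- C z.re * t ^ l); 0, 1], ?_, ?_, hinv _, ?_⟩
  · constructor <;> simp [ev, hl0]
  · constructor <;> simp [ev, hl0]
  · rw [diagLattice_map_rmul (line 1 z) (hinv (- C z.re)), line_map_residueAct]
    · congr 2
      · simp [ev]
      · apply Complex.ext <;> simp [ev]
    · ext i j : 1
      rw [Matrix.mul_apply, Matrix.mul_apply, Fin.sum_univ_two, Fin.sum_univ_two]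
      fin_cases i <;> fin_cases j <;> simp [diag, pow_add]
      ring

theorem exists_formS_line {k l : ℕ} {μ : ℝ} (hμ : l = 0 → μ ∈ Set.Icc (-1 : ℝ) 1)
    (hle : diagLattice ![k, k + l] (line 1 (Complex.I * μ)) ≤ P)
    (hne : diagLattice ![k, k + l] (line 1 (Complex.I * μ)) ≠ P) :
    ∃ p : FormS, p.IsNormalized ∧
      p.lattice = diagLattice ![k, k + l] (line 1 (Complex.I * μ)) := by
  have hk : 1 ≤ k := by
    by_contra hk
    obtain rfl : k = 0 := by omega
    -- For `k = 0` the diagonal condition of `P` on this matrix reads `1 = μ` if `l = 0` and `1 = 0`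
    -- if `l ≥ 1`. The first alternative is the excluded lattice `P` itself.
    have h1 : rmul (diag ![0, 0 + l]) (lift ![1, Complex.I * μ]) ∈ P :=
      hle ⟨_, mem_residueLattice.2 (by
        rw [residue_lift]
        exact Submodule.mem_span_singleton_self _), rfl⟩
    have h2 := h1.1
    rw [rmul_diag_entry, rmul_diag_entry] at h2
    by_cases hl : l = 0
    · subst hl
      simp [lift, ev] at h2
      subst h2
      apply hne
      rw [P_eq_residueLattice, ← diagLattice_zero]
      congr 2
      · funext j
        fin_cases j <;> rfl
      · simp
    · simp [lift, ev, hl] at h2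
  by_cases h0 : μ = 0
  · subst h0
    exact ⟨.LQ k l hk, trivial, by simp [FormS.lattice, FormS.exponents, FormS.subspace]⟩
  · exact ⟨.PP k l μ hk h0, hμ, rfl⟩

/-- Properness is assumed for all equivalent lattices because the lattice is compared with `P` only
after its line has been normalised. -/
theorem exists_formS_rightEquiv {k l : ℕ} {W : Submodule ℂ (Fin 2 → ℂ)}
    (hle : diagLattice ![k, k + l] W ≤ P)
    (hne : ∀ N', RightEquiv (diagLattice ![k, k + l] W) N' → N' ≠ P) :
    ∃ p : FormS, p.IsNormalized ∧ RightEquiv (diagLattice ![k, k + l] W) p.lattice := by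
  rcases subspace_fin_two W with rfl | rfl | ⟨u, v, huv, rfl⟩
  · exact ⟨.QQ k l, trivial, .refl _⟩
  · have hk : 1 ≤ k := by
      by_contra hk
      obtain rfl : k = 0 := by omega
      have h1 : rmul (diag ![0, 0 + l]) (lift ![1, 0]) ∈ P :=
        hle ⟨_, mem_residueLattice.2 Submodule.mem_top, rfl⟩
      have h2 := h1.1
      rw [rmul_diag_entry, rmul_diag_entry] at h2
      simp [lift, ev] at h2
    exact ⟨.LL k l hk, trivial, .refl _⟩
  · have finish : ∀ μ : ℝ, (l = 0 → μ ∈ Set.Icc (-1 : ℝ) 1) →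
        RightEquiv (diagLattice ![k, k + l] (line u v))
          (diagLattice ![k, k + l] (line 1 (Complex.I * μ))) →
        ∃ p : FormS, p.IsNormalized ∧
          RightEquiv (diagLattice ![k, k + l] (line u v)) p.lattice := by
      intro μ hμ hE
      obtain ⟨p, hp, hp'⟩ := exists_formS_line hμ (hE.le hle) (hne _ hE)
      exact ⟨p, hp, hp' ▸ hE⟩
    by_cases hl : l = 0
    · subst hl
      obtain ⟨c, s, hcs, μ, hμ, hμ'⟩ := exists_rotation_line huv
      exact finish μ (fun _ => hμ) (hμ' ▸ rightEquiv_line_rotation k u v hcs)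
    · have hl1 : 1 ≤ l := by omega
      by_cases hu : u = 0
      · subst hu
        have hv : v ≠ 0 := huv.resolve_left (by simp)
        refine ⟨.LQ' k l hl1, trivial, ?_⟩
        have : line 0 v = line 0 1 := by
          rw [← line_smul hv 0 1, mul_zero, mul_one]
        rw [this]
        exact .refl _
      · have h1 : line u v = line 1 (v / u) := by
          rw [← line_smul hu 1, mul_one, mul_div_cancel₀ _ hu]
        refine finish (v / u).im (fun h => absurd h hl) ?_
        rw [h1]
        exact rightEquiv_line_shear k hl1 _

theorem exists_formS {N : Submodule A P} (hN : N ≠ ⊤) [Module.Finite ℝ (P ⧸ N)] :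
    ∃ p : FormS, p.IsNormalized ∧ Nonempty ((P ⧸ N) ≃ₗ[A] p.Mod) := by
  obtain ⟨r, hr0, hr⟩ := exists_scalar_smul_eq_zero (P ⧸ N)
  set N₁ := N.map P.subtype with hN₁
  have hNN : N₁.submoduleOf P = N := submoduleOf_map_subtype N
  have hrow : ∀ v : Fin 2 → R, lastRow (r • v) ∈ N₁ := by
    intro v
    have hvP : lastRow v ∈ P := by constructor <;> simp [lastRow_entry, ev]
    have h1 : scalar r • (⟨lastRow v, hvP⟩ : P) ∈ N :=
      (Submodule.Quotient.mk_eq_zero N).1 (hr (Submodule.Quotient.mk _))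
    have h2 : scalar r • lastRow v ∈ N₁ := ⟨_, h1, rfl⟩
    convert lastRow_mem_of_mem h2 2 using 2
    funext j
    rw [scalar_smul_entry]
    simp [lastRow_entry]
  obtain ⟨N₂, hE, k, l, hkl⟩ := exists_rightEquiv_rows N₁ hr0 hrow
  obtain ⟨W, rfl⟩ := exists_eq_diagLattice N₂ _ hkl
  have hle₁ : N₁ ≤ P := Submodule.map_subtype_le _ _
  obtain ⟨p, hp, hp'⟩ := exists_formS_rightEquiv (hE.le hle₁) (by
    -- Automorphisms of `P` map `P` onto itself, so only `P` is equivalent to `P`.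
    rintro N' hN' rfl
    have h1 : RightEquiv P N₁ := (hE.trans hN').symm
    obtain ⟨Y, Y', hY, hY', hYY', h2⟩ := h1
    apply hN
    rw [← hNN, Submodule.submoduleOf, Submodule.comap_subtype_eq_top, ← h2]
    intro x hx
    exact ⟨rmul Y' x, hY'.rmul_mem hx, by rw [rmul_rmul, mul_eq_one_comm.1 hYY', rmul_one]⟩)
  obtain ⟨φ⟩ := (hE.trans hp').nonempty_quotient_equiv
  obtain ⟨ψ⟩ := p.nonempty_equiv_lattice
  exact ⟨p, hp, ⟨(Submodule.quotEquivOfEq _ _ hNN.symm).trans (φ.trans ψ.symm)⟩⟩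

/-! ### Uniqueness of the normal form -/

/-- An isomorphism between quotients of `P` lifts to an endomorphism of `P` that is nonzero
on the top. -/
theorem exists_isEndP_of_equiv {N N' : Submodule A (Mat 2)} (hN : N ≤ P)
    (hN' : N'.submoduleOf P ≠ ⊤)
    (φ : (P ⧸ N.submoduleOf P) ≃ₗ[A] (P ⧸ N'.submoduleOf P)) :
    ∃ Y, IsEndP Y ∧ (ev (Y 0 0) ≠ 0 ∨ ev (Y 1 0) ≠ 0) ∧ ∀ x ∈ N, rmul Y x ∈ N' := by
  -- The lift is determined by a preimage `y` of the image of the generator: it is right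
  -- multiplication by the upper `2 × 2` block of `y`.
  obtain ⟨y, hy⟩ := (N'.submoduleOf P).mkQ_surjective (φ ((N.submoduleOf P).mkQ genP))
  have hφ : ∀ x : P, φ ((N.submoduleOf P).mkQ x) = (N'.submoduleOf P).mkQ (embP x • y) := by
    intro x
    rw [map_smul, hy, ← map_smul, ← map_smul, embP_smul_genP]
  let Y : Matrix (Fin 2) (Fin 2) R := fun i j => y.1 i.castSucc j
  have hYmul : ∀ x : P, (embP x • y).1 = rmul Y x.1 := by
    intro x
    apply Mat.ext
    intro i j
    change (embP x • y.1) i j = _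
    rw [embP_smul_entry, rmul_two_entry]
    rfl
  refine ⟨Y, y.2, ?_, ?_⟩
  -- If `y` vanished in the top of `P`, the image of `φ` would lie in the radical, contrary to
  -- surjectivity.
  · by_contra! h0
    have hytop : topP y = 0 := Complex.ext h0.1 h0.2
    obtain ⟨z, hz⟩ := exists_ne (0 : S)
    obtain ⟨w, rfl⟩ := topP_surjective z
    obtain ⟨v, hv⟩ := φ.surjective ((N'.submoduleOf P).mkQ w)
    obtain ⟨x, rfl⟩ := (N.submoduleOf P).mkQ_surjective v
    rw [hφ, ← sub_eq_zero, ← map_sub] at hv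
    have h1 := le_ker_topP _ hN' ((Submodule.Quotient.mk_eq_zero _).1 hv)
    rw [LinearMap.mem_ker, map_sub, map_smul, hytop, smul_zero, zero_sub, neg_eq_zero] at h1
    exact hz h1
  · intro x hx
    have h1 := hφ ⟨x, hN hx⟩
    have h2 : (N.submoduleOf P).mkQ ⟨x, hN hx⟩ = 0 := (Submodule.Quotient.mk_eq_zero _).2 hx
    rw [h2, map_zero] at h1
    have h3 := (Submodule.Quotient.mk_eq_zero _).1 h1.symm
    have h4 : (embP ⟨x, hN hx⟩ • y).1 ∈ N' := h3
    rwa [hYmul] at h4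

theorem t_pow_dvd_of_mem_diagLattice {n : ℕ} {d : Fin n → ℕ} {W : Submodule ℂ (Fin n → ℂ)}
    {x : Mat n} (hx : x ∈ diagLattice d W) (i : Fin 3) (j : Fin n) : t ^ d j ∣ x i j := by
  obtain ⟨w, -, rfl⟩ := hx
  rw [rmul_diag_entry]
  exact Dvd.intro_left _ rfl

theorem lastRow_mem_diagLattice (k l : ℕ) (W : Submodule ℂ (Fin 2 → ℂ)) :
    lastRow ![t ^ k, 0] ∈ diagLattice ![k, k + l] W := by
  refine ⟨lastRow ![1, 0], mem_residueLattice.2 ?_, ?_⟩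
  · rw [residue_lastRow]
    exact W.zero_mem
  · apply Mat.ext
    intro i j
    rw [rmul_diag_entry]
    simp only [lastRow_entry]
    split_ifs
    · fin_cases j <;> simp
    · simp

/-- The row `(t ^ k, 0)` is available whatever `W` is, and its image is `t ^ k` times the first row
of `Y`. -/
theorem t_pow_dvd_of_rmul_mem {k l : ℕ} {d' : Fin 2 → ℕ} {W W' : Submodule ℂ (Fin 2 → ℂ)}
    {Y : Matrix (Fin 2) (Fin 2) R}
    (h : ∀ x ∈ diagLattice ![k, k + l] W, rmul Y x ∈ diagLattice d' W') (j : Fin 2) :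
    t ^ d' j ∣ t ^ k * Y 0 j := by
  have h1 := t_pow_dvd_of_mem_diagLattice (h _ (lastRow_mem_diagLattice k l W)) 2 j
  rw [rmul_two_entry] at h1
  simpa [lastRow_entry] using h1

theorem le_of_t_pow_dvd_mul {k k' : ℕ} {y : R} (hy : ev y ≠ 0) (h : t ^ k' ∣ t ^ k * y) :
    k' ≤ k := by
  have h1 : t ^ k' ∣ t ^ k := by
    have h2 := Dvd.dvd.mul_right h y⁻¹
    rwa [mul_assoc, PowerSeries.mul_inv_cancel y hy, mul_one] at h2
  exact (pow_dvd_pow_iff PowerSeries.X_ne_zero PowerSeries.X_prime.not_isUnit).1 h1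

theorem exponent_le_of_rmul_mem {k l k' l' : ℕ} {W W' : Submodule ℂ (Fin 2 → ℂ)}
    {Y : Matrix (Fin 2) (Fin 2) R} (hY : IsEndP Y) (hY0 : ev (Y 0 0) ≠ 0 ∨ ev (Y 1 0) ≠ 0)
    (h : ∀ x ∈ diagLattice ![k, k + l] W, rmul Y x ∈ diagLattice ![k', k' + l'] W') : k' ≤ k := by
  rcases hY0 with h0 | h0
  · exact le_of_t_pow_dvd_mul h0 (t_pow_dvd_of_rmul_mem h 0)
  · rw [hY.2, neg_ne_zero] at h0
    exact (Nat.le_add_right _ _).trans (le_of_t_pow_dvd_mul h0 (t_pow_dvd_of_rmul_mem h 1))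

theorem rmul_diag_injective {n : ℕ} (d : Fin n → ℕ) : Function.Injective (rmul (diag d)) := by
  intro x y h
  apply Mat.ext
  intro i j
  have h1 : rmul (diag d) x i j = rmul (diag d) y i j := by rw [h]
  rw [rmul_diag_entry, rmul_diag_entry] at h1
  exact mul_right_cancel₀ (pow_ne_zero _ PowerSeries.X_ne_zero) h1

/-- The action on the complex subspaces of an endomorphism of `P` that maps a lattice to a lattice
with the same exponents. -/
theorem subspace_action {k l : ℕ} {W W' : Submodule ℂ (Fin 2 → ℂ)}
    {Y : Matrix (Fin 2) (Fin 2) R} (hY : IsEndP Y) (hY0 : ev (Y 0 0) ≠ 0 ∨ ev (Y 1 0) ≠ 0)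
    (h : ∀ x ∈ diagLattice ![k, k + l] W, rmul Y x ∈ diagLattice ![k, k + l] W') :
    (1 ≤ l ∧ ∃ a b : ℝ, a ≠ 0 ∧ ∀ u v : ℂ, ![u, v] ∈ W → ![u * a, u * b + v * a] ∈ W') ∨
    (l = 0 ∧ ∃ a b : ℝ, (a ≠ 0 ∨ b ≠ 0) ∧ ∀ u v : ℂ, ![u, v] ∈ W →
      ![u * a + v * b, v * a - u * b] ∈ W') := by
  -- This divisibility makes the conjugate of `Y` by the diagonal matrix integral; its constant part
  -- is what acts on the subspaces.
  obtain ⟨y, hy⟩ : t ^ l ∣ Y 0 1 := by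
    have h1 : t ^ (k + l) ∣ t ^ k * Y 0 1 := t_pow_dvd_of_rmul_mem h 1
    rw [pow_add] at h1
    exact (mul_dvd_mul_iff_left (pow_ne_zero k PowerSeries.X_ne_zero)).1 h1
  obtain ⟨h1, h2⟩ := hY
  have key : ∀ u v : ℂ, ![u, v] ∈ W →
      residueAct !![Y 0 0, y; t ^ l * Y 1 0, Y 1 1] ![u, v] ∈ W' := by
    intro u v huv
    obtain ⟨w, hw, hw'⟩ := h (rmul (diag ![k, k + l]) (lift ![u, v]))
      ⟨_, mem_residueLattice.2 (by rwa [residue_lift]), rfl⟩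
    have hcomm : diag ![k, k + l] * Y =
        !![Y 0 0, y; t ^ l * Y 1 0, Y 1 1] * diag ![k, k + l] := by
      ext i j : 1
      rw [Matrix.mul_apply, Matrix.mul_apply, Fin.sum_univ_two, Fin.sum_univ_two]
      fin_cases i <;> fin_cases j <;> simp [diag, pow_add, hy] <;> ring
    rw [rmul_rmul, hcomm, ← rmul_rmul] at hw'
    have h3 := rmul_diag_injective _ hw'
    rw [← residue_lift ![u, v], ← residue_rmul, ← h3]
    exact hw
  simp only [residueAct_two] at key
  simp only [ev] at *
  by_cases hl : l = 0
  · right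
    subst hl
    rw [pow_zero, one_mul] at hy
    refine ⟨rfl, constantCoeff (Y 0 0), constantCoeff (Y 1 0), hY0, fun u v huv => ?_⟩
    convert key u v huv using 1
    funext j
    fin_cases j
    · simp
    · simp [← hy, h1, h2]
      ring
  · left
    -- For `l ≥ 1` the constant part of `Y` is thus a real scalar, and it is nonzero by `hY0`.
    have hy0 : constantCoeff (Y 0 1) = 0 := by simp [hy, hl]
    rw [h2, hy0] at hY0
    refine ⟨by omega, constantCoeff (Y 0 0), constantCoeff y, by simpa using hY0,
      fun u v huv => ?_⟩
    convert key u v huv using 1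
    funext j
    fin_cases j
    · simp [hl]
    · simp [h1]

namespace FormS

theorem exponents_eq (p : FormS) : ∃ k l : ℕ, p.exponents = ![k, k + l] ∧
    p.dimVector.2 = 2 * k + l := by
  cases p <;> exact ⟨_, _, rfl, rfl⟩

theorem submoduleOf_lattice_ne_top (p : FormS) : p.lattice.submoduleOf P ≠ ⊤ := by
  obtain ⟨φ⟩ := p.nonempty_equiv_lattice
  refine (p.hasDimVector.of_equiv φ).ne_top ?_
  cases p <;> simp only [dimVector] <;> omega

theorem exists_isEndP {p q : FormS} (φ : p.Mod ≃ₗ[A] q.Mod) :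
    ∃ Y, IsEndP Y ∧ (ev (Y 0 0) ≠ 0 ∨ ev (Y 1 0) ≠ 0) ∧
      ∀ x ∈ p.lattice, rmul Y x ∈ q.lattice := by
  obtain ⟨α⟩ := p.nonempty_equiv_lattice
  obtain ⟨β⟩ := q.nonempty_equiv_lattice
  exact exists_isEndP_of_equiv p.lattice_le q.submoduleOf_lattice_ne_top
    (α.symm.trans (φ.trans β))

theorem exponent_le {p q : FormS} (φ : p.Mod ≃ₗ[A] q.Mod) : q.exponents 0 ≤ p.exponents 0 := by
  obtain ⟨Y, hY, hY0, h⟩ := exists_isEndP φ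
  obtain ⟨k, l, hp, -⟩ := p.exponents_eq
  obtain ⟨k', l', hq, -⟩ := q.exponents_eq
  rw [lattice, lattice, hp, hq] at h
  rw [hp, hq]
  exact exponent_le_of_rmul_mem hY hY0 h

/-- The image of `(1, iμ)` is proportional to `(1, iμ')`. As `a` and `b` are real, the imaginary
part of this condition gives `a μ' = a μ`, and for `l = 0` its real part gives `b μ μ' = b`. -/
theorem line_rigid {k l : ℕ} {μ μ' : ℝ} {Y : Matrix (Fin 2) (Fin 2) R} (hY : IsEndP Y)
    (hY0 : ev (Y 0 0) ≠ 0 ∨ ev (Y 1 0) ≠ 0)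
    (h : ∀ x ∈ diagLattice ![k, k + l] (line 1 (Complex.I * μ)),
      rmul Y x ∈ diagLattice ![k, k + l] (line 1 (Complex.I * μ'))) :
    μ' = μ ∨ l = 0 ∧ μ * μ' = 1 := by
  rcases subspace_action hY hY0 h with ⟨-, a, b, ha, hab⟩ | ⟨hl, a, b, ha, hab⟩
  · left
    have h1 := (mem_line_iff (by simp)).1 (hab _ _ (Submodule.mem_span_singleton_self _))
    have h2 := congrArg Complex.im h1
    simp at h2
    exact mul_left_cancel₀ ha (by linarith)
  · have h1 := (mem_line_iff (by simp)).1 (hab _ _ (Submodule.mem_span_singleton_self _))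
    have h2 := congrArg Complex.im h1
    have h3 := congrArg Complex.re h1
    simp at h2 h3
    rcases ha with ha | ha
    · left
      exact mul_left_cancel₀ ha (by linarith)
    · right
      exact ⟨hl, mul_left_cancel₀ ha (by linarith)⟩

/-- For `l ≥ 1` the action multiplies the first coordinate by a nonzero real number, so it cannot
become zero. -/
theorem not_rmul_mem_line_zero_one {k l : ℕ} {z : ℂ} {Y : Matrix (Fin 2) (Fin 2) R}
    (hY : IsEndP Y) (hY0 : ev (Y 0 0) ≠ 0 ∨ ev (Y 1 0) ≠ 0) (hl : 1 ≤ l) :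
    ¬ ∀ x ∈ diagLattice ![k, k + l] (line 1 z), rmul Y x ∈ diagLattice ![k, k + l] (line 0 1) := by
  intro h
  rcases subspace_action hY hY0 h with ⟨-, a, b, ha, hab⟩ | ⟨hl0, -⟩
  · have h1 := (mem_line_iff (by simp)).1 (hab _ _ (Submodule.mem_span_singleton_self _))
    simp [ha] at h1
  · omega

theorem not_rmul_mem_of_line_zero_one {k l : ℕ} {z : ℂ} {Y : Matrix (Fin 2) (Fin 2) R}
    (hY : IsEndP Y) (hY0 : ev (Y 0 0) ≠ 0 ∨ ev (Y 1 0) ≠ 0) (hl : 1 ≤ l) :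
    ¬ ∀ x ∈ diagLattice ![k, k + l] (line 0 1), rmul Y x ∈ diagLattice ![k, k + l] (line 1 z) := by
  intro h
  rcases subspace_action hY hY0 h with ⟨-, a, b, ha, hab⟩ | ⟨hl0, -⟩
  · have h1 := (mem_line_iff (by simp)).1 (hab _ _ (Submodule.mem_span_singleton_self _))
    exact ha (by simpa using h1.symm)
  · omega

/-- Isomorphic cokernels have the same parameters, except that the real parameter can be inverted
if `l = 0`. -/
theorem eq_or_of_equiv {p q : FormS} (φ : p.Mod ≃ₗ[A] q.Mod) :
    p = q ∨ ∃ k c c' hk hc hc', p = PP k 0 c hk hc ∧ q = PP k 0 c' hk hc' ∧ c * c' = 1 := by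
  have h1 := exponent_le φ
  have h2 := exponent_le φ.symm
  have hdim : p.dimVector = q.dimVector := (p.hasDimVector.of_equiv φ).unique q.hasDimVector
  obtain ⟨Y, hY, hY0, h⟩ := exists_isEndP φ
  -- The difference of the two components of the dimension vector is `1` for `QQ`, `-1` for `LL` and
  -- `0` for the other three, so only eleven pairs survive.
  cases p <;> cases q <;> simp only [exponents, dimVector, Prod.mk.injEq, Matrix.cons_val_zero,
    lattice, subspace] at h1 h2 hdim h <;> try omega
  case QQ.QQ k l k' l' =>
    obtain rfl : k' = k := by omega
    obtain rfl : l' = l := by omega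
    exact Or.inl rfl
  case LL.LL k l hk k' l' hk' =>
    obtain rfl : k' = k := by omega
    obtain rfl : l' = l := by omega
    exact Or.inl rfl
  case LQ.LQ k l hk k' l' hk' =>
    obtain rfl : k' = k := by omega
    obtain rfl : l' = l := by omega
    exact Or.inl rfl
  case LQ'.LQ' k l hl k' l' hl' =>
    obtain rfl : k' = k := by omega
    obtain rfl : l' = l := by omega
    exact Or.inl rfl
  case LQ.LQ' k l hk k' l' hl' =>
    obtain rfl : k' = k := by omega
    obtain rfl : l' = l := by omega
    exact absurd h (not_rmul_mem_line_zero_one hY hY0 hl')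
  case PP.LQ' k l c hk hc k' l' hl' =>
    obtain rfl : k' = k := by omega
    obtain rfl : l' = l := by omega
    exact absurd h (not_rmul_mem_line_zero_one hY hY0 hl')
  case LQ'.LQ k l hl k' l' hk' =>
    obtain rfl : k' = k := by omega
    obtain rfl : l' = l := by omega
    exact absurd h (not_rmul_mem_of_line_zero_one hY hY0 hl)
  case LQ'.PP k l hl k' l' c hk' hc =>
    obtain rfl : k' = k := by omega
    obtain rfl : l' = l := by omega
    exact absurd h (not_rmul_mem_of_line_zero_one hY hY0 hl)
  case LQ.PP k l hk k' l' c hk' hc =>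
    obtain rfl : k' = k := by omega
    obtain rfl : l' = l := by omega
    -- `LQ` is the member `μ = 0` of the family of lines, so rigidity also separates it from `PP`.
    have h0 : (0 : ℂ) = Complex.I * (0 : ℝ) := by simp
    rw [h0] at h
    rcases line_rigid hY hY0 h with h3 | ⟨-, h3⟩
    · exact absurd h3 hc
    · simp at h3
  case PP.LQ k l c hk hc k' l' hk' =>
    obtain rfl : k' = k := by omega
    obtain rfl : l' = l := by omega
    have h0 : (0 : ℂ) = Complex.I * (0 : ℝ) := by simp
    rw [h0] at h
    rcases line_rigid hY hY0 h with h3 | ⟨-, h3⟩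
    · exact absurd h3.symm hc
    · simp at h3
  case PP.PP k l c hk hc k' l' c' hk' hc' =>
    obtain rfl : k' = k := by omega
    obtain rfl : l' = l := by omega
    rcases line_rigid hY hY0 h with rfl | ⟨rfl, h3⟩
    · exact Or.inl rfl
    · exact Or.inr ⟨k', c, c', hk, hc, hc', rfl, rfl, h3⟩

theorem eq_of_equiv_of_isNormalized {p q : FormS} (hp : p.IsNormalized) (hq : q.IsNormalized)
    (φ : p.Mod ≃ₗ[A] q.Mod) : p = q := by
  rcases eq_or_of_equiv φ with h | ⟨k, c, c', hk, hc, hc', rfl, rfl, h⟩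
  · exact h
  · obtain ⟨h1, h2⟩ := hp rfl
    obtain ⟨h3, h4⟩ := hq rfl
    -- From `c c' = 1` the signs agree, and both absolute values are at most `1`; hence `c = c' =
    -- ±1`.
    have : c = c' := by
      rcases lt_or_gt_of_ne hc with h0 | h0
      · have h5 : c' < 0 := by
          by_contra! h6
          nlinarith [mul_nonneg (neg_pos.2 h0).le h6]
        nlinarith
      · have h5 : 0 < c' := by
          by_contra! h6
          nlinarith [mul_nonneg h0.le (neg_nonneg.2 h6)]
        nlinarith
    subst this
    rfl

/-- A quarter turn sends `(1, ic)` to `(ic, -1) = ic · (1, i c⁻¹)`. -/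
theorem nonempty_PP_equiv_inv {k : ℕ} {c : ℝ} (hk : 1 ≤ k) (hc : c ≠ 0) (hc' : c⁻¹ ≠ 0) :
    Nonempty ((PP k 0 c hk hc).Mod ≃ₗ[A] (PP k 0 c⁻¹ hk hc').Mod) := by
  obtain ⟨α⟩ := (PP k 0 c hk hc).nonempty_equiv_lattice
  obtain ⟨β⟩ := (PP k 0 c⁻¹ hk hc').nonempty_equiv_lattice
  have hE := rightEquiv_line_rotation k 1 (Complex.I * c) (c := 0) (s := 1) (by simp)
  have hcc : (c : ℂ) ≠ 0 := Complex.ofReal_ne_zero.2 hc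
  have hline : line (1 * ((0 : ℝ) : ℂ) + Complex.I * c * ((1 : ℝ) : ℂ))
      (Complex.I * c * ((0 : ℝ) : ℂ) - 1 * ((1 : ℝ) : ℂ)) = line 1 (Complex.I * (c⁻¹ : ℝ)) := by
    rw [← line_smul (mul_ne_zero Complex.I_ne_zero hcc) 1]
    congr 1
    · simp
    · push_cast
      field_simp
      rw [Complex.I_sq]
      ring
  rw [hline] at hE
  obtain ⟨γ⟩ := hE.nonempty_quotient_equiv
  exact ⟨α.trans (γ.trans β.symm)⟩

theorem nonempty_PP_equiv_iff (k l k' l' : ℕ) (c c' : ℝ) (hk : 1 ≤ k) (hk' : 1 ≤ k') (hc : c ≠ 0)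
    (hc' : c' ≠ 0) : Nonempty ((PP k l c hk hc).Mod ≃ₗ[A] (PP k' l' c' hk' hc').Mod) ↔
      k' = k ∧ l' = l ∧ (c' = c ∨ (l = 0 ∧ c' = c⁻¹)) := by
  constructor
  · rintro ⟨φ⟩
    rcases eq_or_of_equiv φ with h | ⟨k₀, c₀, c₁, _, _, _, h1, h2, h3⟩
    · injection h with h1 h2 h3
      exact ⟨h1.symm, h2.symm, Or.inl h3.symm⟩
    · injection h1 with h4 h5 h6
      injection h2 with h7 h8 h9
      subst h4 h5 h6 h7 h8 h9
      exact ⟨rfl, rfl, Or.inr ⟨rfl, eq_inv_of_mul_eq_one_right h3⟩⟩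
  · rintro ⟨rfl, rfl, rfl | ⟨rfl, rfl⟩⟩
    · exact ⟨LinearEquiv.refl A _⟩
    · exact nonempty_PP_equiv_inv hk hc hc'

end FormS

theorem existsUnique_formS {M : Type*} [AddCommGroup M] [Module ℝ M] [Module A M]
    [IsScalarTower ℝ A M] (hM : IsAbsolutelyCyclic M) (hS : Nonempty (TopOf M ≃ₗ[A] S)) :
    ∃! p : FormS, p.IsNormalized ∧ Nonempty (M ≃ₗ[A] p.Mod) := by
  obtain ⟨N, hN, ⟨φ⟩⟩ := hM.exists_quotient_of_top_S hS
  have := hM.finite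
  have : Module.Finite ℝ (P ⧸ N) := Module.Finite.equiv (φ.restrictScalars ℝ)
  obtain ⟨p, hp, ⟨ψ⟩⟩ := exists_formS hN
  refine ⟨p, ⟨hp, ⟨φ.trans ψ⟩⟩, ?_⟩
  rintro q ⟨hq, ⟨χ⟩⟩
  exact FormS.eq_of_equiv_of_isNormalized hq hp (χ.symm.trans (φ.trans ψ))

end RealGelfand

end

open RealGelfand in
theorem theoremT :
    -- every absolutely cyclic module has top isomorphic to `T` or to `S`
    (∀ (M : Type*) [AddCommGroup M] [Module ℝ M] [Module A M] [IsScalarTower ℝ A M],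
      IsAbsolutelyCyclic M →
        Nonempty (TopOf M ≃ₗ[A] T) ∨ Nonempty (TopOf M ≃ₗ[A] S)) ∧
    -- top `T`: exactly one normal form
    (∀ (M : Type*) [AddCommGroup M] [Module ℝ M] [Module A M] [IsScalarTower ℝ A M],
      IsAbsolutelyCyclic M → Nonempty (TopOf M ≃ₗ[A] T) →
        ∃! p : FormT, Nonempty (M ≃ₗ[A] p.Mod)) ∧
    (∀ p : FormT, IsAbsolutelyCyclic p.Mod ∧ Nonempty (TopOf p.Mod ≃ₗ[A] T) ∧
      HasDimVector p.Mod p.dimVector) ∧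
    -- top `S`: exactly one normal form with normalised real parameter
    (∀ (M : Type*) [AddCommGroup M] [Module ℝ M] [Module A M] [IsScalarTower ℝ A M],
      IsAbsolutelyCyclic M → Nonempty (TopOf M ≃ₗ[A] S) →
        ∃! p : FormS, p.IsNormalized ∧ Nonempty (M ≃ₗ[A] p.Mod)) ∧
    (∀ p : FormS, IsAbsolutelyCyclic p.Mod ∧ Nonempty (TopOf p.Mod ≃ₗ[A] S) ∧
      HasDimVector p.Mod p.dimVector) ∧
    -- the isomorphisms between the modules of the family with a real parameter
    (∀ (k l k' l' : ℕ) (c c' : ℝ) (hk : 1 ≤ k) (hk' : 1 ≤ k') (hc : c ≠ 0) (hc' : c' ≠ 0),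
      Nonempty ((FormS.PP k l c hk hc).Mod ≃ₗ[A] (FormS.PP k' l' c' hk' hc').Mod) ↔
        k' = k ∧ l' = l ∧ (c' = c ∨ (l = 0 ∧ c' = c⁻¹))) := by
  refine ⟨?_, ?_, isAbsolutelyCyclic_formT, ?_, isAbsolutelyCyclic_formS,
    FormS.nonempty_PP_equiv_iff⟩
  · intro M _ _ _ _ hM
    exact hM.top
  · intro M _ _ _ _ hM hT
    exact existsUnique_formT hM hT
  · intro M _ _ _ _ hM hS
    exact existsUnique_formS hM hS
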